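/- The game Dots \& Polygons is played on a finite set $P$ of $n$ points in the plane by two players, $\mathcal R$ and $\mathcal B$; player $\mathcal R$ moves first and initially nothing is drawn. In a move, the player to move connects two points of $P$ by a straight-line edge that meets no other point of $P$ and no previously drawn edge (except at common endpoints) and that does not lie in previously scored area. If the edge closes a polygon, the player scores the area enclosed by it, excluding parts enclosed before, and must move again; otherwise the turn passes to the opponent. The game ends when all area of the convex hull of $P$ has been scored. In the variant Dots \& Polygons \& Holes every closed cycle of edges counts as a polygon; in the variant Dots \& Simple Polygons only simple polygons with no point of $P$ inside count. **Theorem.** Let $P$ be a set of $n$ points in the plane in (strictly) convex position, i.e. no point of $P$ lies in the convex hull of the others. In either variant of the game, if $n\in\{3,5,7\}$ then player $\mathcal R$ has a strategy that guarantees $\mathcal R$ a final score of at least half of the area of the convex hull of $P$, and if $n\in\{4,6\}$ then player $\mathcal B$ has a strategy that guarantees $\mathcal B$ a final score of at least half of that area. -/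

import Mathlib

namespace DotsPolygons

/-- The Euclidean plane. -/
abbrev Plane : Type := EuclideanSpace ℝ (Fin 2)

/-- The two players. -/
inductive Player : Type where
  | R : Player
  | B : Player
  deriving DecidableEq

/-- The opponent of a player. -/
def Player.other : Player → Player
  | Player.R => Player.B
  | Player.B => Player.R

/-- The two variants of the game: *Dots & Polygons & Holes*, and *Dots & Simple Polygons*. -/
inductive Variant : Type where
  | holes : Variant
  | simple : Variant

section Geometry

variable {V : Type*} (pos : V → Plane)

/-- The closed curve traced by a closed walk in a graph whose vertices are placed in the plane by
`pos` and whose edges are drawn as straight-line segments. -/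
def curve {G : SimpleGraph V} {u : V} (c : G.Walk u u) : Set Plane :=
  {x | ∃ a b : V, s(a, b) ∈ c.edges ∧ x ∈ segment ℝ (pos a) (pos b)}

/-- The (open) region enclosed by a closed walk: the points off its curve that lie in a bounded
connected component of the complement of the curve. -/
def enclosed {G : SimpleGraph V} {u : V} (c : G.Walk u u) : Set Plane :=
  {x | x ∉ curve pos c ∧ Bornology.IsBounded (connectedComponentIn (curve pos c)ᶜ x)}

/-- The closed walk `c` of drawn edges is a polygon that counts for scoring. It has to be a cycle
(as drawn edges do not cross, it then bounds a simple polygon); in *Dots & Simple Polygons* there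
must moreover be no point of the point set inside. -/
def IsScoringPolygon (var : Variant) {G : SimpleGraph V} {u : V} (c : G.Walk u u) : Prop :=
  c.IsCycle ∧ (var = Variant.simple → ∀ v : V, pos v ∉ enclosed pos c)

/-- The area scored so far, as a region of the plane, when `G` is the graph of the drawn edges:
everything enclosed by the closed polygons. -/
def scoredRegion (var : Variant) (G : SimpleGraph V) : Set Plane :=
  {x | ∃ (u : V) (c : G.Walk u u), IsScoringPolygon pos var c ∧ x ∈ enclosed pos c}

/-- The edge `ab` may be drawn when `G` is the graph of the drawn edges: it joins two different
points, meets no other point and no drawn edge (other than at common endpoints; in particular it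
has not been drawn before), and does not lie in the area scored before. -/
def Legal (var : Variant) (G : SimpleGraph V) (a b : V) : Prop :=
  a ≠ b ∧
  (∀ v : V, v ≠ a → v ≠ b → pos v ∉ segment ℝ (pos a) (pos b)) ∧
  (∀ v w : V, G.Adj v w →
    Disjoint (openSegment ℝ (pos a) (pos b)) (openSegment ℝ (pos v) (pos w))) ∧
  ¬ openSegment ℝ (pos a) (pos b) ⊆ scoredRegion pos var G

/-- The graph of the drawn edges after drawing `ab`. -/
def draw (G : SimpleGraph V) (a b : V) : SimpleGraph V :=
  G ⊔ SimpleGraph.edge a b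

/-- Drawing the edge `ab` closes a polygon. -/
def ClosesPolygon (var : Variant) (G : SimpleGraph V) (a b : V) : Prop :=
  ∃ (u : V) (c : (draw G a b).Walk u u), IsScoringPolygon pos var c ∧ s(a, b) ∈ c.edges

/-- The area scored by drawing the edge `ab`: the area of what becomes enclosed, excluding the
parts that were enclosed before. -/
noncomputable def gain (var : Variant) (G : SimpleGraph V) (a b : V) : ℝ :=
  (MeasureTheory.volume (scoredRegion pos var (draw G a b) \ scoredRegion pos var G)).toReal

/-- The area of the convex hull of the point set. -/
noncomputable def hullArea : ℝ :=
  (MeasureTheory.volume (convexHull ℝ (Set.range pos))).toReal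

end Geometry

/-- A game state: the drawn edges, the player to move, and the scores. -/
structure State (V : Type*) where
  drawn : SimpleGraph V
  turn : Player
  score : Player → ℝ

/-- The game starts with nothing drawn, no score, and player `R` to move. -/
def State.initial (V : Type*) : State V where
  drawn := ⊥
  turn := Player.R
  score := fun _ => 0

section Game

variable {V : Type*} (pos : V → Plane)

open Classical in
/-- The state after the player to move draws `ab`: the player scores the newly enclosed area, and
moves again if a polygon was closed; otherwise it is the opponent's turn. -/
noncomputable def State.play (var : Variant) (s : State V) (a b : V) : State V where
  drawn := draw s.drawn a b
  turn := if ClosesPolygon pos var s.drawn a b then s.turn else s.turn.other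
  score := fun X => if X = s.turn then s.score X + gain pos var s.drawn a b else s.score X

/-- The game is over when all area of the convex hull has been scored. -/
def State.IsOver (var : Variant) (s : State V) : Prop :=
  MeasureTheory.volume (convexHull ℝ (Set.range pos) \ scoredRegion pos var s.drawn) = 0

/-- From state `s`, player `X` can force the game to end with a score of at least `t` for `X`,
whatever the opponent does. -/
inductive CanSecure (var : Variant) (X : Player) (t : ℝ) : State V → Prop where
  | over (s : State V) (hover : s.IsOver pos var) (hscore : t ≤ s.score X) :
      CanSecure var X t s
  | ownMove (s : State V) (hover : ¬ s.IsOver pos var) (hturn : s.turn = X) (a b : V)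
      (hlegal : Legal pos var s.drawn a b) (hnext : CanSecure var X t (s.play pos var a b)) :
      CanSecure var X t s
  | opponentMove (s : State V) (hover : ¬ s.IsOver pos var) (hturn : s.turn ≠ X)
      (hexists : ∃ a b : V, Legal pos var s.drawn a b)
      (hnext : ∀ a b : V, Legal pos var s.drawn a b →
        CanSecure var X t (s.play pos var a b)) :
      CanSecure var X t s

end Game

end DotsPolygons

/-!
Let `Z` be the player who moves whenever the number of connected components of the drawing is odd:
`R` if the number `n` of points is odd, `B` if it is even. The turn passes exactly when an edge
joins two components, so this description stays valid throughout the game, and once the drawing is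
connected, `Z` gets all the remaining area. What the opponent scores is limited by `avail`: every
polygon lies inside the convex hull of a component, so before joining two components a player can
score at most the part of these hulls that has not been scored yet.

`Z` always closes all available polygons first. This scores the hulls of all components
completely (`Saturated.volume_hullUnion_diff`), as the sides of the hull of a component are legal
until drawn (`Saturated.adj`), and together they form a cycle that encloses the hull. As long as
at least five components are left, `Z` then joins two isolated points, which makes no area
available (`canSecure_of_isolated`), so that the opponent scores nothing before three components
are left. At this stage `Z` has to make some area available, and the opponent gets no more than
this. It is at most half of the hull if there are two joins for which the areas made available lie
on different sides of a chord (`SeparatedJoins`, `canSecure_of_numComp_eq_three`).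

Such joins exist if one of the three components is a single point (`separatedJoins_of_singleton`),
in particular for `n ≤ 5`, and also if some component contains the ends of a chord and misses
points on both sides of it (`separatedJoins_of_chord`). Counting points shows that one or the
other is the case if some component contains the ends of a diagonal (`n = 6`), or of a diagonal
with at least two points on either side (`n = 7`); see `separatedJoins_of_card_lt`. On six points,
`Z = B` makes sure that one of the first two edges is a diagonal; on seven points, `Z = R` starts
with a diagonal of the required kind.
-/

namespace DotsPolygons

open MeasureTheory

/-! ### Orientation and points in convex position -/

/-- Twice the signed area of the triangle `xyz`: positive iff `z` lies strictly to the left of the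
directed line from `x` to `y`. -/
def orient (x y z : Plane) : ℝ := (y 0 - x 0) * (z 1 - x 1) - (y 1 - x 1) * (z 0 - x 0)

lemma orient_left (x y : Plane) : orient x y x = 0 := by simp [orient]
lemma orient_right (x y : Plane) : orient x y y = 0 := by simp [orient]; ring
lemma orient_rotate (x y z : Plane) : orient y z x = orient x y z := by simp [orient]; ring
lemma orient_swap (x y z : Plane) : orient y x z = -orient x y z := by simp [orient]; ring

lemma orient_comb (x y u w : Plane) {s t : ℝ} (h : s + t = 1) :
    orient x y (s • u + t • w) = s * orient x y u + t * orient x y w := by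
  obtain rfl : s = 1 - t := by linarith
  simp [orient]; ring

lemma orient_add_smul (x y z d : Plane) (t : ℝ) :
    orient x y (z + t • d) = orient x y z + t * ((y 0 - x 0) * d 1 - (y 1 - x 1) * d 0) := by
  simp [orient]; ring

lemma continuous_orient (x y : Plane) : Continuous (orient x y) := by
  unfold orient; fun_prop

lemma convex_orient_nonneg (x y : Plane) : Convex ℝ {z | 0 ≤ orient x y z} := by
  intro u hu w hw s t hs ht hst
  simp only [Set.mem_ofPred_eq] at *
  rw [orient_comb x y u w hst]; positivity

lemma convex_orient_nonpos (x y : Plane) : Convex ℝ {z | orient x y z ≤ 0} := by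
  simpa [orient_swap x y] using convex_orient_nonneg y x

lemma ne_iff_normSq_pos {x y : Plane} : x ≠ y ↔ 0 < (y 0 - x 0) ^ 2 + (y 1 - x 1) ^ 2 := by
  constructor
  · intro h
    by_contra! h'
    apply h
    have h0 : (y 0 - x 0) ^ 2 = 0 :=
      le_antisymm (by nlinarith [sq_nonneg (y 1 - x 1)]) (sq_nonneg _)
    have h1 : (y 1 - x 1) ^ 2 = 0 :=
      le_antisymm (by nlinarith [sq_nonneg (y 0 - x 0)]) (sq_nonneg _)
    ext i
    fin_cases i
    · have := pow_eq_zero_iff (two_ne_zero) |>.1 h0; simp; linarith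
    · have := pow_eq_zero_iff (two_ne_zero) |>.1 h1; simp; linarith
  · rintro h rfl
    simp at h

/-- A point of the line through `x` and `y` is an affine combination of `x` and `y`. -/
lemma exists_eq_of_orient_eq_zero {x y q : Plane} (hxy : x ≠ y) (h : orient x y q = 0) :
    ∃ t : ℝ, q = (1 - t) • x + t • y := by
  have hpos := ne_iff_normSq_pos.1 hxy
  refine ⟨((q 0 - x 0) * (y 0 - x 0) + (q 1 - x 1) * (y 1 - x 1)) /
    ((y 0 - x 0) ^ 2 + (y 1 - x 1) ^ 2), ?_⟩
  unfold orient at h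
  ext i
  fin_cases i
  · simp
    field_simp
    linear_combination (- (y 1 - x 1)) * h
  · simp
    field_simp
    linear_combination ((y 0 - x 0)) * h

/-- A point with nonnegative barycentric coordinates lies in the triangle. -/
lemma mem_convexHull_triangle {x y z p : Plane} (hpos : 0 < orient x y z)
    (hx : 0 ≤ orient y z p) (hy : 0 ≤ orient z x p) (hz : 0 ≤ orient x y p) :
    p ∈ convexHull ℝ {x, y, z} := by
  have hsum : orient y z p + orient z x p + orient x y p = orient x y z := by
    simp [orient]; ring
  have key : p = (orient y z p / orient x y z) • x + (orient z x p / orient x y z) • y +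
      (orient x y p / orient x y z) • z := by
    have h0 := hpos.ne'
    ext i
    fin_cases i
    · simp; field_simp; simp [orient]; ring
    · simp; field_simp; simp [orient]; ring
  rw [convexHull_insert (by simp), convexHull_pair]
  rcases eq_or_lt_of_le (add_nonneg hy hz) with h | h
  · have h1 : orient z x p = 0 := by linarith
    have h2 : orient x y p = 0 := by linarith
    have h3 : orient y z p = orient x y z := by linarith
    rw [h1, h2, h3, div_self hpos.ne'] at key
    simp only [mem_convexJoin]
    refine ⟨x, rfl, y, left_mem_segment _ _ _, ?_⟩
    rw [key]; simp [left_mem_segment]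
  · simp only [mem_convexJoin]
    refine ⟨x, rfl, (orient z x p / (orient z x p + orient x y p)) • y +
      (orient x y p / (orient z x p + orient x y p)) • z,
      ⟨_, _, by positivity, by positivity, by field_simp, rfl⟩,
      orient y z p / orient x y z, (orient z x p + orient x y p) / orient x y z,
      by positivity, by positivity, by field_simp; linarith, ?_⟩
    conv_rhs => rw [key]
    rw [smul_add, smul_smul, smul_smul, add_assoc]
    congr 3
    all_goals field_simp

section

variable {V : Type*} {pos : V → Plane}

/-- The points of a convexly independent family are extreme in its convex hull. -/
lemma not_mem_openSegment_of_mem_convexHull (hc : ConvexIndependent ℝ pos) {x y : V} (hxy : x ≠ y)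
    {q : Plane} (hq : q ∈ convexHull ℝ (Set.range pos)) :
    pos y ∉ openSegment ℝ (pos x) q := by
  rintro ⟨s, t, hs, ht, hst, h⟩
  have hx : pos x ∈ convexHull ℝ (pos '' {y}ᶜ) :=
    subset_convexHull ℝ _ ⟨x, by simpa using hxy, rfl⟩
  have hrange : Set.range pos = insert (pos y) (pos '' {y}ᶜ) := by
    ext z
    simp only [Set.mem_range, Set.mem_insert_iff, Set.mem_image, Set.mem_compl_iff,
      Set.mem_singleton_iff]
    constructor
    · rintro ⟨v, rfl⟩
      by_cases hv : v = y
      · left; rw [hv]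
      · right; exact ⟨v, hv, rfl⟩
    · rintro (rfl | ⟨v, -, rfl⟩)
      · exact ⟨y, rfl⟩
      · exact ⟨v, rfl⟩
  have hne : (pos '' {y}ᶜ).Nonempty := ⟨pos x, x, by simpa using hxy, rfl⟩
  rw [hrange, convexHull_insert hne, mem_convexJoin] at hq
  obtain ⟨_, rfl, q', hq', α, β, hα, hβ, hαβ, rfl⟩ := hq
  refine (convexIndependent_iff_notMem_convexHull_sdiff.1 hc y Set.univ) ?_
  rw [← Set.compl_eq_univ_sdiff]
  have hpos : 0 < s + t * β := by positivity
  have key : pos y = (s / (s + t * β)) • pos x + (t * β / (s + t * β)) • q' := by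
    have : (s + t * β) • pos y = s • pos x + (t * β) • q' := by
      have h1 : s + t * β = 1 - t * α := by
        obtain rfl : β = 1 - α := by linarith
        linarith
      rw [h1, sub_smul, one_smul]
      nth_rewrite 1 [← h]
      rw [smul_add, smul_smul, smul_smul]; abel
    rw [div_eq_inv_mul, div_eq_inv_mul, mul_smul, mul_smul, ← smul_add, ← this, smul_smul,
      inv_mul_cancel₀ hpos.ne', one_smul]
  rw [key]
  exact convex_convexHull ℝ _ hx hq' (by positivity) (by positivity) (by field_simp)

/-- A line through two of the points meets the convex hull in the segment between them. -/
lemma mem_segment_of_orient_eq_zero (hc : ConvexIndependent ℝ pos) {x y : V} (hxy : x ≠ y)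
    {q : Plane} (hq : q ∈ convexHull ℝ (Set.range pos)) (h : orient (pos x) (pos y) q = 0) :
    q ∈ segment ℝ (pos x) (pos y) := by
  obtain ⟨t, rfl⟩ := exists_eq_of_orient_eq_zero (hc.injective.ne hxy) h
  by_cases ht0 : t < 0
  · -- `pos x` would lie strictly between `pos y` and `q`
    refine absurd ?_ (not_mem_openSegment_of_mem_convexHull hc hxy.symm hq)
    have h1 : 0 < 1 - t := by linarith
    refine ⟨-t / (1 - t), 1 / (1 - t), div_pos (by linarith) h1, by positivity,
      by field_simp; ring, ?_⟩
    rw [smul_add, smul_smul, smul_smul, one_div_mul_cancel h1.ne']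
    module
  by_cases ht1 : 1 < t
  · refine absurd ?_ (not_mem_openSegment_of_mem_convexHull hc hxy hq)
    have h1 : 0 < t := by linarith
    refine ⟨(t - 1) / t, 1 / t, div_pos (by linarith) h1, by positivity,
      by field_simp; ring, ?_⟩
    rw [smul_add, smul_smul, smul_smul, one_div_mul_cancel h1.ne']
    module
  · exact ⟨1 - t, t, by linarith, by linarith, by ring, rfl⟩

/-- No three points are collinear. -/
lemma orient_ne_zero (hc : ConvexIndependent ℝ pos) {x y z : V} (hxy : x ≠ y) (hzx : z ≠ x)
    (hzy : z ≠ y) : orient (pos x) (pos y) (pos z) ≠ 0 := by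
  intro h
  have hmem := mem_segment_of_orient_eq_zero hc hxy
    (subset_convexHull ℝ _ (Set.mem_range_self z)) h
  have hopen := mem_openSegment_of_ne_left_right (hc.injective.ne hzx.symm)
    (hc.injective.ne hzy.symm) hmem
  exact not_mem_openSegment_of_mem_convexHull hc hzx.symm
    (subset_convexHull ℝ _ (Set.mem_range_self y)) hopen

lemma not_mem_segment (hc : ConvexIndependent ℝ pos) {x y z : V} (hzx : z ≠ x)
    (hzy : z ≠ y) : pos z ∉ segment ℝ (pos x) (pos y) := by
  intro hmem
  have hopen := mem_openSegment_of_ne_left_right (hc.injective.ne hzx.symm)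
    (hc.injective.ne hzy.symm) hmem
  exact not_mem_openSegment_of_mem_convexHull hc hzx.symm
    (subset_convexHull ℝ _ (Set.mem_range_self y)) hopen

lemma segment_subset_hull (x y : V) :
    segment ℝ (pos x) (pos y) ⊆ convexHull ℝ (Set.range pos) :=
  (convex_convexHull ℝ _).segment_subset (subset_convexHull ℝ _ (Set.mem_range_self x))
    (subset_convexHull ℝ _ (Set.mem_range_self y))

lemma orient_eq_zero_of_mem_segment {x y q : Plane} (h : q ∈ segment ℝ x y) :
    orient x y q = 0 := by
  obtain ⟨s, t, -, -, hst, rfl⟩ := h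
  rw [orient_comb _ _ _ _ hst, orient_left, orient_right]; simp

/-- If `v` and `w` lie strictly on different sides of the chord `ab`, the chords cross. -/
lemma not_disjoint_of_orient_neg (hc : ConvexIndependent ℝ pos) {a b v w : V} (hab : a ≠ b)
    (h : orient (pos a) (pos b) (pos v) * orient (pos a) (pos b) (pos w) < 0) :
    ¬ Disjoint (openSegment ℝ (pos a) (pos b)) (openSegment ℝ (pos v) (pos w)) := by
  set F := orient (pos a) (pos b) with hF
  have hva : v ≠ a := by rintro rfl; simp [hF, orient_left] at h
  have hvb : v ≠ b := by rintro rfl; simp [hF, orient_right] at h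
  obtain ⟨s, t, hs, ht, hst, hz⟩ : ∃ s t : ℝ, 0 < s ∧ 0 < t ∧ s + t = 1 ∧
      s * F (pos v) + t * F (pos w) = 0 := by
    rcases mul_neg_iff.1 h with ⟨h1, h2⟩ | ⟨h1, h2⟩
    · have h3 : 0 < F (pos v) - F (pos w) := by linarith
      exact ⟨-F (pos w) / (F (pos v) - F (pos w)), F (pos v) / (F (pos v) - F (pos w)),
        div_pos (by linarith) h3, div_pos h1 h3, by field_simp; ring, by field_simp; ring⟩
    · have h3 : 0 < F (pos w) - F (pos v) := by linarith
      exact ⟨F (pos w) / (F (pos w) - F (pos v)), -F (pos v) / (F (pos w) - F (pos v)),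
        div_pos h2 h3, div_pos (by linarith) h3, by field_simp; ring, by field_simp; ring⟩
  have hq : s • pos v + t • pos w ∈ openSegment ℝ (pos v) (pos w) := ⟨s, t, hs, ht, hst, rfl⟩
  have hwH : pos w ∈ convexHull ℝ (Set.range pos) := subset_convexHull ℝ _ (Set.mem_range_self w)
  refine Set.not_disjoint_iff.2 ⟨_, mem_openSegment_of_ne_left_right ?_ ?_ ?_, hq⟩
  · intro he
    exact not_mem_openSegment_of_mem_convexHull hc hva hwH (he ▸ hq)
  · intro he
    exact not_mem_openSegment_of_mem_convexHull hc hvb hwH (he ▸ hq)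
  · refine mem_segment_of_orient_eq_zero hc hab
      (segment_subset_hull v w (openSegment_subset_segment _ _ _ hq)) ?_
    rw [orient_comb _ _ _ _ hst]; exact hz

/-- If two chords without a common end cross, the ends of one lie on different sides of the
other. -/
lemma orient_neg_of_not_disjoint (hc : ConvexIndependent ℝ pos) {a b v w : V}
    (hvw : v ≠ w) (hav : a ≠ v) (haw : a ≠ w)
    (h : ¬ Disjoint (openSegment ℝ (pos a) (pos b)) (openSegment ℝ (pos v) (pos w))) :
    orient (pos v) (pos w) (pos a) * orient (pos v) (pos w) (pos b) < 0 := by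
  obtain ⟨q, ⟨s, t, hs, ht, hst, rfl⟩, hq⟩ := Set.not_disjoint_iff.1 h
  have h0 := orient_eq_zero_of_mem_segment (openSegment_subset_segment _ _ _ hq)
  rw [orient_comb _ _ _ _ hst] at h0
  have hne := orient_ne_zero hc hvw hav haw
  have : t * orient (pos v) (pos w) (pos b) = -(s * orient (pos v) (pos w) (pos a)) := by linarith
  have h2 : t * (orient (pos v) (pos w) (pos a) * orient (pos v) (pos w) (pos b)) < 0 := by
    have hsq : 0 < orient (pos v) (pos w) (pos a) ^ 2 := by positivity
    calc t * (orient (pos v) (pos w) (pos a) * orient (pos v) (pos w) (pos b))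
        = orient (pos v) (pos w) (pos a) * (t * orient (pos v) (pos w) (pos b)) := by ring
      _ = -(s * orient (pos v) (pos w) (pos a) ^ 2) := by rw [this]; ring
      _ < 0 := by nlinarith
  by_contra! h3
  nlinarith

/-- Two chords are disjoint if the second lies on one side of the first, except possibly for one
common end. -/
lemma disjoint_of_orient_nonneg {a b v w : Plane}
    (hv : 0 ≤ orient a b v) (hw : 0 ≤ orient a b w) (h : orient a b v ≠ 0 ∨ orient a b w ≠ 0) :
    Disjoint (openSegment ℝ a b) (openSegment ℝ v w) := by
  rw [Set.disjoint_left]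
  rintro q hq ⟨s, t, hs, ht, hst, rfl⟩
  have h0 := orient_eq_zero_of_mem_segment (openSegment_subset_segment _ _ _ hq)
  rw [orient_comb _ _ _ _ hst] at h0
  rcases h with h | h
  · have := lt_of_le_of_ne hv h.symm
    nlinarith [mul_pos hs this, mul_nonneg ht.le hw]
  · have := lt_of_le_of_ne hw h.symm
    nlinarith [mul_pos ht this, mul_nonneg hs.le hv]

lemma eq_or_eq_of_orient_eq_zero (hc : ConvexIndependent ℝ pos) {a b v : V} (hab : a ≠ b)
    (h : orient (pos a) (pos b) (pos v) = 0) : v = a ∨ v = b := by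
  by_contra! h'
  exact orient_ne_zero hc hab h'.1 h'.2 h

/-- Adding points on one side of a chord `xy` of a set does not change its hull on the other
side of the chord. -/
lemma mem_convexHull_of_orient_neg (hc : ConvexIndependent ℝ pos) {x y : V} (hxy : x ≠ y)
    {S T : Set V} (hx : x ∈ S) (hy : y ∈ S) (hT : ∀ z ∈ T, 0 ≤ orient (pos x) (pos y) (pos z))
    {p : Plane} (hp : p ∈ convexHull ℝ (pos '' (S ∪ T))) (hneg : orient (pos x) (pos y) p < 0) :
    p ∈ convexHull ℝ (pos '' S) := by
  rcases T.eq_empty_or_nonempty with rfl | hTne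
  · simpa using hp
  rw [Set.image_union, convexHull_union (Set.Nonempty.image _ ⟨x, hx⟩) (hTne.image _),
    mem_convexJoin] at hp
  obtain ⟨u, hu, w, hw, s, t, hs, ht, hst, rfl⟩ := hp
  have hw0 : 0 ≤ orient (pos x) (pos y) w := by
    refine convexHull_min ?_ (convex_orient_nonneg (pos x) (pos y)) hw
    rintro _ ⟨z, hz, rfl⟩; exact hT z hz
  rw [orient_comb _ _ _ _ hst] at hneg
  set F := orient (pos x) (pos y) with hF
  have hu0 : F u < 0 := by
    by_contra! h
    nlinarith [mul_nonneg hs h, mul_nonneg ht hw0]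
  have hD : 0 < F w - F u := by linarith
  -- the segment `uw` meets the chord in `q`, and the point lies between `u` and `q`
  set q := (F w / (F w - F u)) • u + (-F u / (F w - F u)) • w with hqdef
  have hqsum : F w / (F w - F u) + -F u / (F w - F u) = 1 := by field_simp; ring
  have hqH : q ∈ convexHull ℝ (Set.range pos) :=
    convex_convexHull ℝ _ (convexHull_mono (Set.image_subset_range _ _) hu)
      (convexHull_mono (Set.image_subset_range _ _) hw) (by positivity)
      (div_nonneg (by linarith) hD.le) hqsum
  have hq0 : F q = 0 := by
    rw [hqdef, hF, orient_comb _ _ _ _ hqsum, ← hF]; field_simp; ring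
  have hqS : q ∈ convexHull ℝ (pos '' S) :=
    (convex_convexHull ℝ _).segment_subset (subset_convexHull ℝ _ (Set.mem_image_of_mem pos hx))
      (subset_convexHull ℝ _ (Set.mem_image_of_mem pos hy))
      (mem_segment_of_orient_eq_zero hc hxy hqH hq0)
  have hcoef : t * (F w - F u) ≤ -F u := by
    obtain rfl : s = 1 - t := by linarith
    nlinarith
  have hr : t * (F w - F u) / (-F u) ≤ 1 := by
    rw [div_le_one (by linarith)]; exact hcoef
  have hFu : F u ≠ 0 := hu0.ne
  have key : s • u + t • w =
      (1 - t * (F w - F u) / (-F u)) • u + (t * (F w - F u) / (-F u)) • q := by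
    rw [hqdef, smul_add, smul_smul, smul_smul, ← add_assoc, ← add_smul]
    obtain rfl : s = 1 - t := by linarith
    congr 2
    · field_simp; ring
    · field_simp
  rw [key]
  exact convex_convexHull ℝ _ hu hqS (by linarith)
    (div_nonneg (mul_nonneg ht hD.le) (by linarith)) (by ring)

end

lemma volume_orient_eq_zero {x y : Plane} (hxy : x ≠ y) :
    volume {z : Plane | orient x y z = 0} = 0 := by
  let A : AffineSubspace ℝ Plane :=
    { carrier := {z | orient x y z = 0}
      smul_vsub_vadd_mem' := by
        intro c p q r hp hq hr
        simp only [Set.mem_ofPred_eq, orient, vsub_eq_sub, vadd_eq_add, PiLp.add_apply,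
          PiLp.smul_apply, PiLp.sub_apply, smul_eq_mul] at *
        linear_combination c * hp - c * hq + hr }
  refine Measure.addHaar_affineSubspace volume A ?_
  intro htop
  have hmem : x + (1 : ℝ) • !₂[-(y 1 - x 1), y 0 - x 0] ∈ A := by rw [htop]; trivial
  have h0 : orient x y (x + (1 : ℝ) • !₂[-(y 1 - x 1), y 0 - x 0]) = 0 := hmem
  rw [orient_add_smul, orient_left] at h0
  have := ne_iff_normSq_pos.1 hxy
  simp at h0
  nlinarith

lemma volume_segment_eq_zero {V : Type*} {pos : V → Plane} (hc : ConvexIndependent ℝ pos)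
    (a b : V) : volume (segment ℝ (pos a) (pos b)) = 0 := by
  by_cases hab : a = b
  · subst hab; simp [segment_same]
  · exact measure_mono_null (fun q hq => orient_eq_zero_of_mem_segment hq)
      (volume_orient_eq_zero (hc.injective.ne hab))

/-! ### Polygons, scored area and components -/

section

variable {V : Type*} {pos : V → Plane} {G : SimpleGraph V}

lemma segment_subset_curve {u a b : V} {c : G.Walk u u} (h : s(a, b) ∈ c.edges) :
    segment ℝ (pos a) (pos b) ⊆ curve pos c := fun _ hx => ⟨a, b, h, hx⟩

lemma curve_subset_convexHull {u : V} (c : G.Walk u u) :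
    curve pos c ⊆ convexHull ℝ (pos '' {v | v ∈ c.support}) := by
  rintro x ⟨a, b, hab, hx⟩
  exact (convex_convexHull ℝ _).segment_subset
    (subset_convexHull ℝ _ (Set.mem_image_of_mem pos (c.fst_mem_support_of_mem_edges hab)))
    (subset_convexHull ℝ _ (Set.mem_image_of_mem pos (c.snd_mem_support_of_mem_edges hab))) hx

lemma isClosed_curve [Finite V] {u : V} (c : G.Walk u u) : IsClosed (curve pos c) := by
  have : curve pos c = ⋃ a, ⋃ b, ⋃ _ : s(a, b) ∈ c.edges, segment ℝ (pos a) (pos b) := by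
    ext x; simp [curve]
  rw [this]
  refine isClosed_iUnion_of_finite fun a => isClosed_iUnion_of_finite fun b =>
    isClosed_iUnion_of_finite fun _ => ?_
  rw [← convexHull_pair]
  exact (Set.toFinite {pos a, pos b}).isClosed_convexHull ℝ

lemma isOpen_enclosed [Finite V] {u : V} (c : G.Walk u u) : IsOpen (enclosed pos c) := by
  have hopen : IsOpen (curve pos c)ᶜ := (isClosed_curve c).isOpen_compl
  rw [isOpen_iff_mem_nhds]
  rintro x ⟨hx, hb⟩
  filter_upwards [hopen.connectedComponentIn.mem_nhds (mem_connectedComponentIn hx)] with y hy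
  exact ⟨connectedComponentIn_subset _ _ hy, by rwa [← connectedComponentIn_eq hy]⟩

/-- A point off the convex hull of a polygon is joined to infinity by a ray that leaves the
hull, so it is not enclosed. -/
lemma enclosed_subset_convexHull [Finite V] {u : V} (c : G.Walk u u) :
    enclosed pos c ⊆ convexHull ℝ (pos '' {v | v ∈ c.support}) := by
  rintro x ⟨hx, hb⟩
  by_contra hxK
  set K := convexHull ℝ (pos '' {v | v ∈ c.support}) with hK
  have hKc : IsClosed K := (Set.toFinite _).isClosed_convexHull ℝ
  obtain ⟨g, r, hgx, hgK⟩ := geometric_hahn_banach_point_closed (convex_convexHull ℝ _) hKc hxK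
  have hy0 : pos u ∈ K := subset_convexHull ℝ _ (Set.mem_image_of_mem pos c.start_mem_support)
  set ray : Set Plane := (fun t : ℝ => x + t • (x - pos u)) '' Set.Ici 0 with hray
  have hlt : g x < g (pos u) := hgx.trans (hgK _ hy0)
  have hsub : ray ⊆ (curve pos c)ᶜ := by
    rintro _ ⟨t, ht, rfl⟩ hmem
    have h1 := hgK _ (curve_subset_convexHull c hmem)
    simp only [map_add, map_smul, map_sub, smul_eq_mul] at h1
    have ht' : 0 ≤ t := ht
    nlinarith
  have hconn : IsPreconnected ray := by
    refine isPreconnected_Ici.image _ ?_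
    fun_prop
  have hxray : x ∈ ray := ⟨0, Set.self_mem_Ici, by simp⟩
  have hbr : Bornology.IsBounded ray := hb.subset (hconn.subset_connectedComponentIn hxray hsub)
  obtain ⟨M, hM⟩ := hbr.exists_norm_le
  have hne : 0 < ‖x - pos u‖ := by
    rw [norm_pos_iff, sub_ne_zero]
    rintro rfl; exact lt_irrefl _ hlt
  have hM0 : 0 ≤ M := (norm_nonneg _).trans (hM x hxray)
  have h2 := hM _ ⟨(M + ‖x‖ + 1) / ‖x - pos u‖, Set.mem_Ici.2 (by positivity), rfl⟩
  have h3 := norm_sub_le (x + ((M + ‖x‖ + 1) / ‖x - pos u‖) • (x - pos u)) x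
  rw [add_sub_cancel_left, norm_smul, Real.norm_of_nonneg (by positivity),
    div_mul_cancel₀ _ hne.ne'] at h3
  simp only at h2
  linarith

/-- The interior of a polygon lies strictly on one side of a line that has the whole polygon
weakly on that side. -/
lemma orient_pos_of_mem_enclosed [Finite V] {u : V} {c : G.Walk u u} {a b x : Plane} (hab : a ≠ b)
    (h : ∀ v ∈ c.support, 0 ≤ orient a b (pos v)) (hx : x ∈ enclosed pos c) :
    0 < orient a b x := by
  have hsub : enclosed pos c ⊆ {z | 0 ≤ orient a b z} := by
    refine (enclosed_subset_convexHull c).trans (convexHull_min ?_ (convex_orient_nonneg a b))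
    rintro _ ⟨v, hv, rfl⟩; exact h v hv
  refine lt_of_le_of_ne (hsub hx) fun h0 => ?_
  set d : Plane := !₂[-(b 1 - a 1), b 0 - a 0] with hd
  have hcont : Filter.Tendsto (fun t : ℝ => x + t • d) (nhds 0) (nhds x) := by
    have : Continuous (fun t : ℝ => x + t • d) := by fun_prop
    simpa using this.tendsto 0
  have hev := hcont ((isOpen_enclosed c).mem_nhds hx)
  obtain ⟨ε, hε, hball⟩ := Metric.mem_nhds_iff.1 hev
  have hmem : -(ε / 2) ∈ Metric.ball (0 : ℝ) ε := by
    rw [Metric.mem_ball, dist_zero_right, norm_neg, Real.norm_of_nonneg (by positivity)]; linarith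
  have h1 : 0 ≤ orient a b (x + (-(ε / 2)) • d) := hsub (hball hmem)
  rw [orient_add_smul, ← h0] at h1
  have := ne_iff_normSq_pos.1 hab
  simp only [hd, PiLp.toLp_apply, Matrix.cons_val_zero, Matrix.cons_val_one] at h1
  nlinarith

/-- In convex position no point lies inside a polygon, so both variants score every cycle. -/
lemma isScoringPolygon_iff [Finite V] (hc : ConvexIndependent ℝ pos) {var : Variant} {u : V}
    {c : G.Walk u u} : IsScoringPolygon pos var c ↔ c.IsCycle := by
  refine ⟨fun h => h.1, fun h => ⟨h, fun _ v hv => hv.1 ?_⟩⟩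
  have h1 : v ∈ {v | v ∈ c.support} := hc _ v (enclosed_subset_convexHull c hv)
  obtain ⟨e, he, hve⟩ := (SimpleGraph.Walk.mem_support_iff_exists_mem_edges_of_not_nil
    (by exact h.not_nil)).1 h1
  induction e using Sym2.ind with
  | _ a b =>
    rcases Sym2.mem_iff.1 hve with rfl | rfl
    · exact segment_subset_curve he (left_mem_segment _ _ _)
    · exact segment_subset_curve he (right_mem_segment _ _ _)

/-- The connected component of `v`, as a set of vertices. -/
def comp (G : SimpleGraph V) (v : V) : Set V := {w | G.Reachable v w}

lemma support_subset_comp {u a : V} (c : G.Walk u u) (ha : a ∈ c.support) :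
    {v | v ∈ c.support} ⊆ comp G a := by
  classical
  exact fun _ hv => ⟨(c.takeUntil _ ha).reverse.append (c.takeUntil _ hv)⟩

/-- The union of the convex hulls of the connected components: the area that can be scored
without joining components. -/
def hullUnion (pos : V → Plane) (G : SimpleGraph V) : Set Plane :=
  ⋃ v, convexHull ℝ (pos '' comp G v)

lemma isOpen_scoredRegion [Finite V] (var : Variant) : IsOpen (scoredRegion pos var G) := by
  have : scoredRegion pos var G =
      ⋃ (u : V) (c : G.Walk u u) (_ : IsScoringPolygon pos var c), enclosed pos c := by
    ext x; simp [scoredRegion]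
  rw [this]
  exact isOpen_iUnion fun u => isOpen_iUnion fun c => isOpen_iUnion fun _ => isOpen_enclosed c

lemma scoredRegion_subset_hullUnion [Finite V] (var : Variant) :
    scoredRegion pos var G ⊆ hullUnion pos G := by
  rintro x ⟨u, c, -, hx⟩
  refine Set.mem_iUnion.2 ⟨u, convexHull_mono (Set.image_mono ?_) (enclosed_subset_convexHull c hx)⟩
  exact support_subset_comp c c.start_mem_support

lemma hullUnion_subset_hull : hullUnion pos G ⊆ convexHull ℝ (Set.range pos) :=
  Set.iUnion_subset fun _ => convexHull_mono (Set.image_subset_range _ _)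

lemma volume_hull_ne_top [Finite V] : volume (convexHull ℝ (Set.range pos)) ≠ ⊤ :=
  ((Set.finite_range pos).isCompact_convexHull ℝ).measure_ne_top

lemma measurableSet_hullUnion [Finite V] : MeasurableSet (hullUnion pos G) :=
  .iUnion fun _ => ((Set.toFinite _).isClosed_convexHull ℝ).measurableSet

lemma volume_ne_top_of_subset_hull [Finite V] {S : Set Plane}
    (h : S ⊆ convexHull ℝ (Set.range pos)) : volume S ≠ ⊤ :=
  measure_ne_top_of_subset h volume_hull_ne_top

lemma scoredRegion_mono [Finite V] (hc : ConvexIndependent ℝ pos) (var : Variant)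
    {G' : SimpleGraph V} (h : G ≤ G') : scoredRegion pos var G ⊆ scoredRegion pos var G' := by
  rintro x ⟨u, c, hcyc, hx⟩
  refine ⟨u, c.mapLe h,
    (isScoringPolygon_iff hc).2 (((isScoringPolygon_iff hc).1 hcyc).mapLe h), ?_⟩
  have : curve pos (c.mapLe h) = curve pos c := by
    ext y; simp [curve]
  simpa [enclosed, this] using hx

lemma volume_scoredRegion_bot [Finite V] (hc : ConvexIndependent ℝ pos) (var : Variant) :
    volume (scoredRegion pos var (⊥ : SimpleGraph V)) = 0 := by
  have : scoredRegion pos var (⊥ : SimpleGraph V) = ∅ := by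
    rw [Set.eq_empty_iff_forall_notMem]
    rintro x ⟨u, c, hcyc, -⟩
    have h := ((isScoringPolygon_iff hc).1 hcyc)
    cases c with
    | nil => exact h.not_nil SimpleGraph.Walk.nil_nil
    | cons _ _ => exact (SimpleGraph.bot_adj _ _).1 ‹_›
  rw [this, measure_empty]

end

section

variable {V : Type*} {G : SimpleGraph V}

lemma draw_adj {a b v w : V} (hab : a ≠ b) :
    (draw G a b).Adj v w ↔ G.Adj v w ∨ s(v, w) = s(a, b) := by
  simp only [draw, SimpleGraph.sup_adj, SimpleGraph.edge_adj, Sym2.eq_iff]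
  constructor
  · rintro (h | ⟨h, -⟩) <;> tauto
  · rintro (h | h)
    · exact .inl h
    · refine .inr ⟨h, ?_⟩
      rcases h with ⟨rfl, rfl⟩ | ⟨rfl, rfl⟩
      exacts [hab, hab.symm]

lemma le_draw (a b : V) : G ≤ draw G a b := le_sup_left

lemma draw_adj_self {a b : V} (hab : a ≠ b) : (draw G a b).Adj a b := (draw_adj hab).2 (.inr rfl)

lemma reachable_draw_iff {a b u v : V} (hab : a ≠ b) : (draw G a b).Reachable u v ↔
    G.Reachable u v ∨ (G.Reachable u a ∧ G.Reachable b v) ∨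
      (G.Reachable u b ∧ G.Reachable a v) := by
  have hle : G ≤ draw G a b := le_draw a b
  have hR : (draw G a b).Reachable a b := (draw_adj_self hab).reachable
  constructor
  · rintro ⟨p⟩
    induction p with
    | nil => exact .inl .rfl
    | @cons u w v h p ih =>
      rcases (draw_adj hab).1 h with h | h
      · have h' := h.reachable
        rcases ih with ih | ⟨ih1, ih2⟩ | ⟨ih1, ih2⟩
        · exact .inl (h'.trans ih)
        · exact .inr (.inl ⟨h'.trans ih1, ih2⟩)
        · exact .inr (.inr ⟨h'.trans ih1, ih2⟩)
      · rcases Sym2.eq_iff.1 h with ⟨rfl, rfl⟩ | ⟨rfl, rfl⟩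
        · rcases ih with ih | ⟨ih1, ih2⟩ | ⟨ih1, ih2⟩
          · exact .inr (.inl ⟨.rfl, ih⟩)
          · exact .inr (.inl ⟨.rfl, ih2⟩)
          · exact .inl ih2
        · rcases ih with ih | ⟨ih1, ih2⟩ | ⟨ih1, ih2⟩
          · exact .inr (.inr ⟨.rfl, ih⟩)
          · exact .inl ih2
          · exact .inr (.inr ⟨.rfl, ih2⟩)
  · rintro (h | ⟨h1, h2⟩ | ⟨h1, h2⟩)
    · exact h.mono hle
    · exact (h1.mono hle).trans (hR.trans (h2.mono hle))
    · exact (h1.mono hle).trans (hR.symm.trans (h2.mono hle))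

lemma reachable_draw_of_reachable {a b u v : V} (hab : a ≠ b) (h : G.Reachable a b) :
    (draw G a b).Reachable u v ↔ G.Reachable u v := by
  rw [reachable_draw_iff hab]
  constructor
  · rintro (h' | ⟨h1, h2⟩ | ⟨h1, h2⟩)
    · exact h'
    · exact h1.trans (h.trans h2)
    · exact h1.trans (h.symm.trans h2)
  · exact .inl

/-- The number of connected components. -/
noncomputable def numComp (G : SimpleGraph V) : ℕ := Nat.card G.ConnectedComponent

lemma numComp_eq_of_reachable_iff {G' : SimpleGraph V}
    (h : ∀ u v, G'.Reachable u v ↔ G.Reachable u v) : numComp G' = numComp G := by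
  refine Nat.card_congr (Quot.congr (Equiv.refl V) ?_)
  intro u v; exact h u v

lemma numComp_draw [Finite V] {a b : V} (h : ¬ G.Reachable a b) :
    numComp (draw G a b) + 1 = numComp G := by
  classical
  have hab : a ≠ b := by rintro rfl; exact h .rfl
  have hbij : Function.Bijective
      (fun C : {C : G.ConnectedComponent // C ≠ G.connectedComponentMk b} =>
      (C.1.map (SimpleGraph.Hom.ofLE (le_draw a b)) : (draw G a b).ConnectedComponent)) := by
    constructor
    · rintro ⟨C, hC⟩ ⟨D, hD⟩ hCD
      induction C using SimpleGraph.ConnectedComponent.ind with | _ u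
      induction D using SimpleGraph.ConnectedComponent.ind with | _ v
      simp only [SimpleGraph.ConnectedComponent.map_mk, SimpleGraph.Hom.coe_ofLE, id_eq, ne_eq,
        SimpleGraph.ConnectedComponent.eq] at hCD hC hD
      rw [reachable_draw_iff hab] at hCD
      simp only [Subtype.mk.injEq, SimpleGraph.ConnectedComponent.eq]
      rcases hCD with h' | ⟨-, h2⟩ | ⟨h1, -⟩
      · exact h'
      · exact absurd h2.symm hD
      · exact absurd h1 hC
    · intro C
      induction C using SimpleGraph.ConnectedComponent.ind with | _ u
      by_cases hu : G.Reachable u b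
      · refine ⟨⟨G.connectedComponentMk a, by simpa using h⟩, ?_⟩
        simp only [SimpleGraph.ConnectedComponent.map_mk, SimpleGraph.Hom.coe_ofLE, id_eq,
          SimpleGraph.ConnectedComponent.eq, reachable_draw_iff hab]
        exact .inr (.inl ⟨.rfl, hu.symm⟩)
      · exact ⟨⟨G.connectedComponentMk u, by simpa using hu⟩, rfl⟩
  have h1 := Nat.card_congr (Equiv.ofBijective _ hbij)
  have h2 : Nat.card {C : G.ConnectedComponent // C ≠ G.connectedComponentMk b} + 1 =
      Nat.card G.ConnectedComponent := by
    have := Fintype.ofFinite G.ConnectedComponent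
    simp only [Nat.card_eq_fintype_card]
    have hpos : 0 < Fintype.card G.ConnectedComponent :=
      Fintype.card_pos_iff.2 ⟨G.connectedComponentMk b⟩
    rw [Fintype.card_subtype_compl, Fintype.card_subtype_eq]
    omega
  rw [numComp, numComp, ← h1, h2]

lemma numComp_bot : numComp (⊥ : SimpleGraph V) = Nat.card V := by
  refine (Nat.card_congr (Equiv.ofBijective (⊥ : SimpleGraph V).connectedComponentMk ⟨?_, ?_⟩)).symm
  · intro u v h
    simpa using SimpleGraph.ConnectedComponent.exact h
  · intro C
    induction C using SimpleGraph.ConnectedComponent.ind with | _ u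
    exact ⟨u, rfl⟩

/-- The connected components, numbered. -/
lemma exists_label {k : ℕ} [Finite V] (h : numComp G = k) : ∃ l : V → Fin k,
    Function.Surjective l ∧ ∀ u v, l u = l v ↔ G.Reachable u v := by
  let e := Finite.equivFinOfCardEq h
  refine ⟨fun v => e (G.connectedComponentMk v), ?_, fun u v => ?_⟩
  · intro i
    obtain ⟨v, hv⟩ := (e.symm i).exists_rep
    exact ⟨v, by
      show e (Quot.mk _ v) = i
      rw [hv]; simp⟩
  · simp

end

lemma closesPolygon_iff {V : Type*} [Finite V] {pos : V → Plane} (hc : ConvexIndependent ℝ pos)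
    {var : Variant} {G : SimpleGraph V} {a b : V} (hab : a ≠ b) (hadj : ¬ G.Adj a b) :
    ClosesPolygon pos var G a b ↔ G.Reachable a b := by
  have h1 : (draw G a b).deleteEdges {s(a, b)} = G := by
    ext v w
    simp only [SimpleGraph.deleteEdges_adj, draw_adj hab, Set.mem_singleton_iff]
    constructor
    · rintro ⟨h | h, h'⟩
      · exact h
      · exact absurd h h'
    · intro h
      refine ⟨.inl h, fun h' => hadj ?_⟩
      rcases Sym2.eq_iff.1 h' with ⟨rfl, rfl⟩ | ⟨rfl, rfl⟩
      exacts [h, h.symm]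
  have h2 := SimpleGraph.adj_and_reachable_delete_edges_iff_exists_cycle (G := draw G a b) (v := a)
    (w := b)
  rw [h1] at h2
  simp only [ClosesPolygon, isScoringPolygon_iff hc]
  rw [← h2]
  simp [draw_adj_self hab]

/-! ### Noncrossing drawings and legal edges -/

section

variable {V : Type*} {pos : V → Plane} {G : SimpleGraph V}

/-- The drawn edges meet in common ends only. -/
def Noncrossing (pos : V → Plane) (G : SimpleGraph V) : Prop :=
  ∀ v w x y, G.Adj v w → G.Adj x y → s(v, w) ≠ s(x, y) →
    Disjoint (openSegment ℝ (pos v) (pos w)) (openSegment ℝ (pos x) (pos y))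

lemma openSegment_congr {a b v w : V} (h : s(v, w) = s(a, b)) :
    openSegment ℝ (pos v) (pos w) = openSegment ℝ (pos a) (pos b) := by
  rcases Sym2.eq_iff.1 h with ⟨rfl, rfl⟩ | ⟨rfl, rfl⟩
  exacts [rfl, openSegment_symm _ _ _]

lemma Noncrossing.draw {var : Variant} {a b : V} (h : Noncrossing pos G)
    (hl : Legal pos var G a b) : Noncrossing pos (draw G a b) := by
  intro v w x y hvw hxy hne
  rcases (draw_adj hl.1).1 hvw with h1 | h1 <;> rcases (draw_adj hl.1).1 hxy with h2 | h2
  · exact h v w x y h1 h2 hne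
  · rw [openSegment_congr h2]; exact (hl.2.2.1 v w h1).symm
  · rw [openSegment_congr h1]; exact hl.2.2.1 x y h2
  · exact absurd (h1.trans h2.symm) hne

lemma Legal.not_adj {var : Variant} {a b : V} (hl : Legal pos var G a b) : ¬ G.Adj a b := by
  intro h
  have := hl.2.2.1 a b h
  rw [disjoint_self] at this
  have hne : (openSegment ℝ (pos a) (pos b)).Nonempty :=
    ⟨_, 1 / 2, 1 / 2, by norm_num, by norm_num, by norm_num, rfl⟩
  exact hne.ne_empty this

/-- A component with vertices on both sides of a drawn edge contains that edge. -/
lemma Noncrossing.reachable_of_adj (hc : ConvexIndependent ℝ pos) (h : Noncrossing pos G)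
    {a b v w : V} (hvw : G.Adj v w) (hab : G.Reachable a b)
    (hneg : orient (pos v) (pos w) (pos a) * orient (pos v) (pos w) (pos b) < 0) :
    G.Reachable a v := by
  by_contra hav
  obtain ⟨p⟩ := hab
  set F := orient (pos v) (pos w) with hF
  have hFa : F (pos a) ≠ 0 := by rintro h0; simp [h0] at hneg
  obtain ⟨d, hd, hd1, hd2⟩ := p.exists_boundary_dart {z | 0 < F (pos a) * F (pos z)}
    (mul_self_pos.2 hFa) (not_lt.2 hneg.le)
  have hfst : G.Reachable a d.fst := by
    classical exact ⟨p.takeUntil _ (p.dart_fst_mem_support_of_mem_darts hd)⟩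
  have hsnd : G.Reachable a d.snd := hfst.trans d.adj.reachable
  have hne : F (pos d.snd) ≠ 0 := by
    refine orient_ne_zero hc hvw.ne ?_ ?_
    · rintro h0; exact hav (h0 ▸ hsnd)
    · rintro h0; exact hav ((h0 ▸ hsnd).trans hvw.symm.reachable)
  have hlt : F (pos d.fst) * F (pos d.snd) < 0 := by
    have h1 : 0 < F (pos a) * F (pos d.fst) := hd1
    have h2 : F (pos a) * F (pos d.snd) < 0 :=
      lt_of_le_of_ne (not_lt.1 hd2) (mul_ne_zero hFa hne)
    have h3 := mul_neg_of_pos_of_neg h1 h2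
    have h4 : 0 < F (pos a) ^ 2 := by positivity
    by_contra! h5
    nlinarith [mul_nonneg h4.le h5]
  refine not_disjoint_of_orient_neg hc hvw.ne hlt (h v w _ _ hvw d.adj ?_)
  intro heq
  rcases Sym2.eq_iff.1 heq with ⟨h1, -⟩ | ⟨h1, -⟩
  · exact hav (h1 ▸ hfst)
  · exact hav (h1 ▸ hsnd)

/-- Two components that interleave are equal. -/
lemma Noncrossing.reachable_of_orient_neg (hc : ConvexIndependent ℝ pos) (h : Noncrossing pos G)
    {a b v w : V} (hvw : G.Reachable v w) (hab : G.Reachable a b)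
    (hneg : orient (pos a) (pos b) (pos v) * orient (pos a) (pos b) (pos w) < 0) :
    G.Reachable a v := by
  by_contra hav
  obtain ⟨p⟩ := hvw
  have hab' : a ≠ b := by rintro rfl; simp [orient] at hneg
  set F := orient (pos a) (pos b) with hF
  have hFv : F (pos v) ≠ 0 := by rintro h0; simp [h0] at hneg
  obtain ⟨d, hd, hd1, hd2⟩ := p.exists_boundary_dart {z | 0 < F (pos v) * F (pos z)}
    (mul_self_pos.2 hFv) (not_lt.2 hneg.le)
  have hfst : G.Reachable v d.fst := by
    classical exact ⟨p.takeUntil _ (p.dart_fst_mem_support_of_mem_darts hd)⟩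
  have hsnd : G.Reachable v d.snd := hfst.trans d.adj.reachable
  have hne : F (pos d.snd) ≠ 0 := by
    refine orient_ne_zero hc hab' ?_ ?_
    · rintro h0; exact hav (h0 ▸ hsnd).symm
    · rintro h0; exact hav (hab.trans (h0 ▸ hsnd).symm)
  have hlt : F (pos d.fst) * F (pos d.snd) < 0 := by
    have h1 : 0 < F (pos v) * F (pos d.fst) := hd1
    have h2 : F (pos v) * F (pos d.snd) < 0 :=
      lt_of_le_of_ne (not_lt.1 hd2) (mul_ne_zero hFv hne)
    have h3 := mul_neg_of_pos_of_neg h1 h2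
    have h4 : 0 < F (pos v) ^ 2 := by positivity
    by_contra! h5
    nlinarith [mul_nonneg h4.le h5]
  have hcross := orient_neg_of_not_disjoint hc d.adj.ne
    (fun h0 : a = d.fst => hav (by rw [h0]; exact hfst.symm))
    (fun h0 : a = d.snd => hav (by rw [h0]; exact hsnd.symm))
    (not_disjoint_of_orient_neg hc hab' hlt)
  exact hav ((h.reachable_of_adj hc d.adj hab hcross).trans hfst.symm)

/-- An edge that crosses no drawn edge and has the whole component of one of its ends on one side
is legal: near that end, it does not run through scored area. -/
lemma legal_of_orient_nonneg [Finite V] (hc : ConvexIndependent ℝ pos) {var : Variant} {a b : V}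
    (hab : a ≠ b) (h : ∀ z, G.Reachable a z → 0 ≤ orient (pos a) (pos b) (pos z))
    (hd : ∀ v w, G.Adj v w →
      Disjoint (openSegment ℝ (pos a) (pos b)) (openSegment ℝ (pos v) (pos w))) :
    Legal pos var G a b := by
  refine ⟨hab, fun v hva hvb => not_mem_segment hc hva hvb, hd, fun hsub => ?_⟩
  have hsub' : openSegment ℝ (pos a) (pos b) ⊆ convexHull ℝ (pos '' {a}ᶜ) := by
    intro x hx
    obtain ⟨u, c, -, hxc⟩ := hsub hx
    by_cases hu : G.Reachable u a
    · refine absurd (orient_eq_zero_of_mem_segment (openSegment_subset_segment _ _ _ hx)) ?_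
      refine (orient_pos_of_mem_enclosed (hc.injective.ne hab) (fun v hv => h v ?_) hxc).ne'
      exact hu.symm.trans (support_subset_comp c c.start_mem_support hv)
    · refine convexHull_mono (Set.image_mono ?_) (enclosed_subset_convexHull c hxc)
      rintro v hv rfl
      exact hu (support_subset_comp c c.start_mem_support hv)
  have hcl := closure_minimal hsub' ((Set.toFinite _).isClosed_convexHull ℝ)
  rw [closure_openSegment] at hcl
  exact hc _ a (hcl (left_mem_segment _ _ _)) rfl

/-- No legal edge closes a polygon. -/
def Saturated (pos : V → Plane) (var : Variant) (G : SimpleGraph V) : Prop :=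
  ∀ a b, Legal pos var G a b → ¬ G.Reachable a b

/-- In a saturated drawing, the sides of the hull of each component are drawn. -/
lemma Saturated.adj [Finite V] (hc : ConvexIndependent ℝ pos) {var : Variant}
    (hs : Saturated pos var G) (hG : Noncrossing pos G) {a b : V} (hab : a ≠ b)
    (hr : G.Reachable a b) (h : ∀ z, G.Reachable a z → 0 ≤ orient (pos a) (pos b) (pos z)) :
    G.Adj a b := by
  by_contra hadj
  refine hs a b (legal_of_orient_nonneg hc hab h fun v w hvw => ?_) hr
  by_cases hv : G.Reachable a v
  · refine disjoint_of_orient_nonneg (h v hv) (h w (hv.trans hvw.reachable)) ?_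
    by_contra! h0
    have hvw' := hvw.ne
    rcases eq_or_eq_of_orient_eq_zero hc hab h0.1 with rfl | rfl <;>
      rcases eq_or_eq_of_orient_eq_zero hc hab h0.2 with rfl | rfl
    · exact hvw' rfl
    · exact hadj hvw
    · exact hadj hvw.symm
    · exact hvw' rfl
  · by_contra hnd
    refine hv (hG.reachable_of_adj hc hvw hr (orient_neg_of_not_disjoint hc hvw.ne ?_ ?_ hnd))
    · rintro rfl; exact hv .rfl
    · rintro rfl; exact hv hvw.symm.reachable

/-- A numbering of the points in counterclockwise order. -/
def IsLabelling {n : ℕ} (pos : V → Plane) (e : Fin n ≃ V) : Prop :=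
  ∀ i j k, i < j → j < k → 0 < orient (pos (e i)) (pos (e j)) (pos (e k))

lemma not_mem_convexHull_triangle (hc : ConvexIndependent ℝ pos) {a b c d : V} (ha : d ≠ a)
    (hb : d ≠ b) (hd : d ≠ c) : pos d ∉ convexHull ℝ {pos a, pos b, pos c} := by
  intro h
  have := hc {a, b, c} d (by simpa [Set.image_insert_eq] using h)
  simp [ha, hb, hd] at this

/-- Points in convex position can be numbered counterclockwise from any of them: sort the other
points by angle, as seen from the first. -/
lemma exists_labelling [Finite V] (hc : ConvexIndependent ℝ pos) {n : ℕ}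
    (hn : Nat.card V = n + 1) (p : V) : ∃ e : Fin (n + 1) ≃ V, e 0 = p ∧ IsLabelling pos e := by
  classical
  have htrans : ∀ a b c, a ≠ p → b ≠ p → c ≠ p → 0 < orient (pos p) (pos a) (pos b) →
      0 < orient (pos p) (pos b) (pos c) → 0 < orient (pos p) (pos a) (pos c) := by
    intro a b c ha hb hcp h1 h2
    by_contra! h3
    have h3' : orient (pos c) (pos a) (pos p) = -orient (pos p) (pos a) (pos c) := by
      simp [orient]; ring
    have h1' : orient (pos a) (pos b) (pos p) = orient (pos p) (pos a) (pos b) :=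
      orient_rotate _ _ _
    have h2' : orient (pos b) (pos c) (pos p) = orient (pos p) (pos b) (pos c) :=
      orient_rotate _ _ _
    have hsum : orient (pos b) (pos c) (pos p) + orient (pos c) (pos a) (pos p) +
        orient (pos a) (pos b) (pos p) = orient (pos a) (pos b) (pos c) := by
      simp [orient]; ring
    exact not_mem_convexHull_triangle hc ha.symm hb.symm hcp.symm
      (mem_convexHull_triangle (by linarith) (by linarith) (by linarith) (by linarith))
  let r : V → V → Prop := fun a b => a ≠ b ∧ (a = p ∨ (b ≠ p ∧ 0 < orient (pos p) (pos a) (pos b)))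
  have hneg : ∀ a b, orient (pos p) (pos b) (pos a) = -orient (pos p) (pos a) (pos b) := by
    intro a b; simp [orient]; ring
  have hsto : IsStrictTotalOrder V r :=
    { irrefl := fun a h => h.1 rfl
      trans := by
        rintro a b c ⟨hab, h1⟩ ⟨hbc, h2⟩
        by_cases ha : a = p
        · subst ha
          refine ⟨?_, .inl rfl⟩
          rintro rfl
          rcases h2 with h2 | h2
          · exact hab h2.symm
          · exact h2.1 rfl
        · obtain ⟨hb, h1⟩ := h1.resolve_left ha
          obtain ⟨hcp, h2⟩ := h2.resolve_left hb
          refine ⟨?_, .inr ⟨hcp, htrans a b c ha hb hcp h1 h2⟩⟩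
          rintro rfl
          have := hneg a b
          linarith
      trichotomous := by
        intro a b h1 h2
        by_contra hab
        have hba : b ≠ a := fun h => hab h.symm
        by_cases ha : a = p
        · exact h1 ⟨hab, .inl ha⟩
        by_cases hb : b = p
        · exact h2 ⟨hba, .inl hb⟩
        rcases lt_or_gt_of_ne (orient_ne_zero hc (Ne.symm ha) hb hba) with h | h
        · exact h2 ⟨hba, .inr ⟨ha, by rw [hneg]; linarith⟩⟩
        · exact h1 ⟨hab, .inr ⟨hb, h⟩⟩ }
  let : LinearOrder V := linearOrderOfSTO r
  let := Fintype.ofFinite V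
  have hcard : Fintype.card V = n + 1 := by rw [← Nat.card_eq_fintype_card, hn]
  let e : Fin (n + 1) ≃o V := Fintype.orderIsoFinOfCardEq V hcard
  have hlt : ∀ {a b : V}, a < b → r a b := fun h => h
  have he0 : e 0 = p := by
    by_contra h0
    have h1 : p < e 0 := (⟨fun h => h0 h.symm, .inl rfl⟩ : r p (e 0))
    have h2 : e.symm p < 0 := by simpa using e.symm.strictMono h1
    exact absurd h2 (Fin.not_lt_zero _)
  refine ⟨e.toEquiv, he0, fun i j k hij hjk => ?_⟩
  have hj : e j ≠ p := fun h => by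
    have : j = 0 := e.injective (h.trans he0.symm)
    exact absurd (this ▸ hij) (Fin.not_lt_zero _)
  have hk : e k ≠ p := fun h => by
    have : k = 0 := e.injective (h.trans he0.symm)
    exact absurd (this ▸ hjk) (Fin.not_lt_zero _)
  have h2 := ((hlt (e.strictMono hjk)).2.resolve_left hj).2
  by_cases hi : e i = p
  · simpa [hi] using h2
  have h1 := ((hlt (e.strictMono hij)).2.resolve_left hi).2
  have h3 := htrans _ _ _ hi hj hk h1 h2
  by_contra! h4
  have e1 : orient (pos (e i)) (pos (e k)) (pos (e j)) =
      -orient (pos (e i)) (pos (e j)) (pos (e k)) := by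
    simp [orient]; ring
  have e2 : orient (pos (e k)) (pos p) (pos (e j)) = orient (pos p) (pos (e j)) (pos (e k)) := by
    simp [orient]; ring
  refine not_mem_convexHull_triangle hc hj (e.injective.ne hij.ne') (e.injective.ne hjk.ne)
    (mem_convexHull_triangle h3 ?_ ?_ h1.le)
  · show 0 ≤ orient (pos (e i)) (pos (e k)) (pos (e j))
    rw [e1]; exact neg_nonneg.2 h4
  · rw [e2]; exact h2.le

end

/-! ### Saturated drawings -/

section

variable {V : Type*} {pos : V → Plane} {G : SimpleGraph V}

/-- A closed chain of pairwise different, consecutively adjacent vertices is a cycle. -/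
lemma exists_isCycle_of_adj {q : ℕ → V} {k : ℕ} (hk : 3 ≤ k)
    (hinj : ∀ i j, i < j → j < k → q i ≠ q j) (hadj : ∀ i, i + 1 < k → G.Adj (q i) (q (i + 1)))
    (hlast : G.Adj (q (k - 1)) (q 0)) :
    ∃ c : G.Walk (q (k - 1)) (q (k - 1)), c.IsCycle ∧ s(q (k - 1), q 0) ∈ c.edges ∧
      ∀ i, i + 1 < k → s(q i, q (i + 1)) ∈ c.edges := by
  have hpath : ∀ m, m < k → ∃ w : G.Walk (q 0) (q m), w.IsPath ∧
      (∀ v ∈ w.support, ∃ i ≤ m, v = q i) ∧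
      (∀ e ∈ w.edges, ∃ i < m, e = s(q i, q (i + 1))) ∧
      ∀ i < m, s(q i, q (i + 1)) ∈ w.edges := by
    intro m
    induction m with
    | zero =>
      intro _
      exact ⟨.nil, by simp, by simp, by simp, by simp⟩
    | succ m ih =>
      intro hm
      obtain ⟨w, hw, hsup, hed, hin⟩ := ih (by omega)
      refine ⟨w.concat (hadj m hm), ?_, ?_, ?_, ?_⟩
      · refine hw.concat (fun h => ?_) _
        obtain ⟨i, hi, h⟩ := hsup _ h
        exact hinj i (m + 1) (by omega) hm h.symm
      · intro v hv
        rw [SimpleGraph.Walk.support_concat, List.mem_append] at hv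
        rcases hv with hv | hv
        · obtain ⟨i, hi, h⟩ := hsup v hv
          exact ⟨i, by omega, h⟩
        · exact ⟨m + 1, le_rfl, by simpa using hv⟩
      · intro e he
        rw [SimpleGraph.Walk.edges_concat, List.concat_eq_append, List.mem_append] at he
        rcases he with he | he
        · obtain ⟨i, hi, h⟩ := hed e he
          exact ⟨i, by omega, h⟩
        · exact ⟨m, by omega, by simpa using he⟩
      · intro i hi
        rw [SimpleGraph.Walk.edges_concat, List.concat_eq_append, List.mem_append]
        rcases Nat.lt_succ_iff_lt_or_eq.1 hi with hi | rfl
        · exact .inl (hin i hi)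
        · exact .inr (by simp)
  obtain ⟨w, hw, -, hed, hin⟩ := hpath (k - 1) (by omega)
  refine ⟨.cons hlast w, (SimpleGraph.Walk.cons_isCycle_iff _ _).2 ⟨hw, fun h => ?_⟩, by simp,
    fun i hi => ?_⟩
  · obtain ⟨i, hi, h⟩ := hed _ h
    rcases Sym2.eq_iff.1 h with ⟨h1, -⟩ | ⟨h1, h2⟩
    · exact hinj i (k - 1) hi (by omega) h1.symm
    · rcases Nat.eq_zero_or_pos i with rfl | hi0
      · exact hinj 1 (k - 1) (by omega) (by omega) h1.symm
      · exact hinj 0 i hi0 (by omega) h2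
  · rw [SimpleGraph.Walk.edges_cons]
    exact List.mem_cons_of_mem _ (hin i (by omega))

/-- The points `q 0, …, q (k - 1)` are in counterclockwise order. -/
def IsCounterclockwise (pos : V → Plane) (q : ℕ → V) (k : ℕ) : Prop :=
  ∀ i j l, i < j → j < l → l < k → 0 < orient (pos (q i)) (pos (q j)) (pos (q l))

/-- `ab` is a side of the convex polygon with vertices `q 0, …, q (k - 1)`. -/
def IsSide (q : ℕ → V) (k : ℕ) (a b : V) : Prop :=
  (∃ i, i + 1 < k ∧ a = q i ∧ b = q (i + 1)) ∨ (a = q (k - 1) ∧ b = q 0)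

lemma IsSide.orient_nonneg {q : ℕ → V} {k : ℕ} (hq : IsCounterclockwise pos q k) {a b : V}
    (h : IsSide q k a b) {j : ℕ} (hj : j < k) : 0 ≤ orient (pos a) (pos b) (pos (q j)) := by
  rcases h with ⟨i, hi, rfl, rfl⟩ | ⟨rfl, rfl⟩
  · rcases lt_trichotomy j i with h | rfl | h
    · rw [orient_rotate]
      exact (hq j i (i + 1) h (by omega) hi).le
    · rw [orient_left]
    · rcases Nat.eq_or_lt_of_le (Nat.succ_le_of_lt h) with h | h
      · rw [← h, Nat.succ_eq_add_one, orient_right]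
      · exact (hq i (i + 1) j (by omega) h hj).le
  · rcases Nat.eq_zero_or_pos j with rfl | h
    · rw [orient_right]
    · rcases Nat.eq_or_lt_of_le (Nat.le_sub_one_of_lt hj) with h' | h'
      · rw [h', orient_left]
      · have := hq 0 j (k - 1) h h' (by omega)
        rw [← orient_rotate]
        exact this.le

/-- A point on the inner side of all sides of a convex polygon lies in the polygon: it is in one
of the triangles of the fan at `q 0`. -/
lemma mem_convexHull_of_isSide {q : ℕ → V} {k : ℕ} (hk : 3 ≤ k)
    (hq : IsCounterclockwise pos q k) {y : Plane}
    (hy : ∀ a b, IsSide q k a b → 0 ≤ orient (pos a) (pos b) y) :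
    y ∈ convexHull ℝ (pos '' (q '' Set.Iio k)) := by
  obtain ⟨i, hi1, hik, h1, h2⟩ : ∃ i, 1 ≤ i ∧ i + 1 < k ∧
      0 ≤ orient (pos (q 0)) (pos (q i)) y ∧ orient (pos (q 0)) (pos (q (i + 1))) y ≤ 0 := by
    by_contra! hcon
    have hall : ∀ m, m + 1 < k → 0 ≤ orient (pos (q 0)) (pos (q (m + 1))) y := by
      intro m
      induction m with
      | zero => intro h; exact hy _ _ (.inl ⟨0, h, rfl, rfl⟩)
      | succ m ih => intro h; exact (hcon (m + 1) (by omega) h (ih (by omega))).le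
    have h3 := hcon (k - 2) (by omega) (by omega)
      (by have := hall (k - 3) (by omega); rwa [show k - 3 + 1 = k - 2 by omega] at this)
    rw [show k - 2 + 1 = k - 1 by omega] at h3
    have h4 := hy _ _ (.inr ⟨rfl, rfl⟩)
    rw [orient_swap] at h4
    linarith
  have h3 := hy _ _ (.inl ⟨i, hik, rfl, rfl⟩)
  have hmem := mem_convexHull_triangle (hq 0 i (i + 1) (by omega) (by omega) hik) h3
    (by rw [orient_swap]; linarith) h1
  refine convexHull_mono ?_ hmem
  rintro _ (rfl | rfl | rfl)
  · exact ⟨_, ⟨0, by simp; omega, rfl⟩, rfl⟩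
  · exact ⟨_, ⟨i, by simp; omega, rfl⟩, rfl⟩
  · exact ⟨_, ⟨i + 1, by simp; omega, rfl⟩, rfl⟩

/-- A cycle containing all sides of a convex polygon encloses the polygon. -/
lemma convexHull_subset_enclosed [Finite V] (hc : ConvexIndependent ℝ pos) {q : ℕ → V} {k : ℕ}
    (hk : 3 ≤ k) (hq : IsCounterclockwise pos q k) (hinj : ∀ i j, i < j → j < k → q i ≠ q j)
    {u : V} {c : G.Walk u u} (hside : ∀ a b, IsSide q k a b → s(a, b) ∈ c.edges) :
    convexHull ℝ (pos '' (q '' Set.Iio k)) ⊆ curve pos c ∪ enclosed pos c := by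
  set H := convexHull ℝ (pos '' (q '' Set.Iio k)) with hH
  set W : Set Plane := {y | ∀ a b, IsSide q k a b → 0 < orient (pos a) (pos b) y} with hW
  set K : Set Plane := {y | ∀ a b, IsSide q k a b → 0 ≤ orient (pos a) (pos b) y} with hK
  have hne : ∀ a b, IsSide q k a b → a ≠ b := by
    rintro a b (⟨i, hi, rfl, rfl⟩ | ⟨rfl, rfl⟩)
    · exact hinj i (i + 1) (by omega) hi
    · exact (hinj 0 (k - 1) (by omega) (by omega)).symm
  have hWopen : IsOpen W := by
    have : W = ⋂ a, ⋂ b, ⋂ _ : IsSide q k a b, {y | 0 < orient (pos a) (pos b) y} := by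
      ext; simp [hW]
    rw [this]
    exact isOpen_iInter_of_finite fun a => isOpen_iInter_of_finite fun b =>
      isOpen_iInter_of_finite fun _ => isOpen_lt continuous_const (continuous_orient _ _)
  have hKclosed : IsClosed K := by
    have : K = ⋂ a, ⋂ b, ⋂ _ : IsSide q k a b, {y | 0 ≤ orient (pos a) (pos b) y} := by
      ext; simp [hK]
    rw [this]
    exact isClosed_iInter fun a => isClosed_iInter fun b =>
      isClosed_iInter fun _ => isClosed_le continuous_const (continuous_orient _ _)
  have hWK : W ⊆ K := fun y hy a b hab => (hy a b hab).le
  have hKH : K ⊆ H := fun y hy => mem_convexHull_of_isSide hk hq hy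
  have hHK : H ⊆ K := by
    intro y hy a b hab
    refine convexHull_min ?_ (convex_orient_nonneg (pos a) (pos b)) hy
    rintro _ ⟨_, ⟨j, hj, rfl⟩, rfl⟩
    exact hab.orient_nonneg hq hj
  have hKW : ∀ y ∈ K, y ∉ curve pos c → y ∈ W := by
    intro y hy hyc a b hab
    refine lt_of_le_of_ne (hy a b hab) fun h0 => hyc ?_
    exact segment_subset_curve (hside a b hab) (mem_segment_of_orient_eq_zero hc (hne a b hab)
      (convexHull_mono (Set.image_subset_range _ _) (hKH hy)) h0.symm)
  intro x hx
  by_cases hxc : x ∈ curve pos c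
  · exact .inl hxc
  refine .inr ⟨hxc, ?_⟩
  have hxW : x ∈ W := hKW x (hHK hx) hxc
  have hsub : connectedComponentIn (curve pos c)ᶜ x ⊆ W := by
    refine isPreconnected_connectedComponentIn.subset_of_closure_inter_subset hWopen
      ⟨x, mem_connectedComponentIn hxc, hxW⟩ ?_
    rintro y ⟨hy1, hy2⟩
    exact hKW y (closure_minimal hWK hKclosed hy1) (connectedComponentIn_subset _ _ hy2)
  exact (((Set.toFinite _).isCompact_convexHull ℝ).isBounded.subset hKH).subset (hsub.trans hWK)

/-- Every set of points in convex position can be listed in counterclockwise order. -/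
lemma exists_counterclockwise [Finite V] (hc : ConvexIndependent ℝ pos) (S : Set V)
    (hS : S.Nonempty) : ∃ (q : ℕ → V) (k : ℕ), (∀ i j, i < j → j < k → q i ≠ q j) ∧
      q '' Set.Iio k = S ∧ IsCounterclockwise pos q k := by
  classical
  obtain ⟨p, hp⟩ := hS
  have : Nonempty V := ⟨p⟩
  obtain ⟨n, hn⟩ : ∃ n, Nat.card V = n + 1 :=
    ⟨Nat.card V - 1, by have := Nat.card_pos (α := V); omega⟩
  obtain ⟨e, -, he⟩ := exists_labelling hc hn p
  set F : Finset (Fin (n + 1)) := Finset.univ.filter fun i => e i ∈ S with hF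
  let g := F.orderEmbOfFin rfl
  refine ⟨fun i => if h : i < F.card then e (g ⟨i, h⟩) else p, F.card, ?_, ?_, ?_⟩
  · intro i j hij hj
    have hi : i < F.card := hij.trans hj
    simp only [hi, hj, dif_pos]
    exact e.injective.ne (g.injective.ne (by simp [hij.ne]))
  · ext v
    constructor
    · rintro ⟨i, hi, rfl⟩
      have hi' : i < F.card := hi
      simp only [hi', dif_pos]
      exact (Finset.mem_filter.1 (F.orderEmbOfFin_mem rfl ⟨i, hi'⟩)).2
    · intro hv
      have hmem : e.symm v ∈ (F : Set (Fin (n + 1))) := by simpa [hF] using hv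
      rw [← Finset.range_orderEmbOfFin F rfl] at hmem
      obtain ⟨i, hi⟩ := hmem
      refine ⟨i, i.2, ?_⟩
      have : g i = e.symm v := hi
      simp [this]
  · intro i j l hij hjl hl
    have hj : j < F.card := hjl.trans hl
    have hi : i < F.card := hij.trans hj
    simp only [hi, hj, hl, dif_pos]
    exact he _ _ _ (g.strictMono (by simpa using hij)) (g.strictMono (by simpa using hjl))

/-- In a saturated drawing, the hull of each component has been scored. -/
lemma Saturated.volume_hullUnion_diff [Finite V] (hc : ConvexIndependent ℝ pos) {var : Variant}
    (hs : Saturated pos var G) (hG : Noncrossing pos G) :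
    volume (hullUnion pos G \ scoredRegion pos var G) = 0 := by
  rw [hullUnion, Set.iUnion_sdiff]
  refine measure_iUnion_null fun v => ?_
  obtain ⟨q, k, hinj, himg, hq⟩ := exists_counterclockwise hc (comp G v) ⟨v, .rfl⟩
  have hmem : ∀ j, j < k → G.Reachable v (q j) := fun j hj => by
    have : q j ∈ comp G v := himg ▸ ⟨j, hj, rfl⟩
    exact this
  rcases Nat.lt_or_ge k 3 with hk | hk
  · refine measure_mono_null ?_ (volume_segment_eq_zero hc (q 0) (q 1))
    refine Set.sdiff_subset.trans ?_
    rw [← convexHull_pair, ← himg]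
    refine convexHull_mono ?_
    rintro _ ⟨_, ⟨i, hi, rfl⟩, rfl⟩
    have hi' : i < 3 := lt_trans hi hk
    have hi2 : i < k := hi
    interval_cases i
    · simp
    · simp
    · omega
  have hadj : ∀ a b, IsSide q k a b → G.Adj a b := by
    intro a b hab
    have hav : G.Reachable v a := by
      rcases hab with ⟨i, hi, rfl, rfl⟩ | ⟨rfl, rfl⟩ <;> exact hmem _ (by omega)
    have hbv : G.Reachable v b := by
      rcases hab with ⟨i, hi, rfl, rfl⟩ | ⟨rfl, rfl⟩ <;> exact hmem _ (by omega)
    refine hs.adj hc hG ?_ (hav.symm.trans hbv) fun z hz => ?_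
    · rcases hab with ⟨i, hi, rfl, rfl⟩ | ⟨rfl, rfl⟩
      · exact hinj i (i + 1) (by omega) hi
      · exact (hinj 0 (k - 1) (by omega) (by omega)).symm
    · have hz' : z ∈ comp G v := hav.trans hz
      rw [← himg] at hz'
      obtain ⟨j, hj, rfl⟩ := hz'
      exact hab.orient_nonneg hq hj
  obtain ⟨c, hcyc, hc1, hc2⟩ := exists_isCycle_of_adj hk hinj
    (fun i hi => hadj _ _ (.inl ⟨i, hi, rfl, rfl⟩)) (hadj _ _ (.inr ⟨rfl, rfl⟩))
  have hside : ∀ a b, IsSide q k a b → s(a, b) ∈ c.edges := by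
    rintro a b (⟨i, hi, rfl, rfl⟩ | ⟨rfl, rfl⟩)
    exacts [hc2 i hi, hc1]
  have hsub := convexHull_subset_enclosed hc hk hq hinj hside
  rw [himg] at hsub
  refine measure_mono_null (t := curve pos c) ?_ ?_
  · rintro x ⟨hx, hns⟩
    refine (hsub hx).resolve_right fun h => hns ⟨_, c, (isScoringPolygon_iff hc).2 hcyc, h⟩
  · have : curve pos c ⊆ ⋃ a, ⋃ b, segment ℝ (pos a) (pos b) := by
      rintro x ⟨a, b, -, hx⟩
      exact Set.mem_iUnion₂.2 ⟨a, b, hx⟩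
    exact measure_mono_null this (measure_iUnion_null fun a => measure_iUnion_null fun b =>
      volume_segment_eq_zero hc a b)

end

/-! ### The course of the game -/

section

variable {V : Type*} {pos : V → Plane} {G : SimpleGraph V}

/-- `ab` is a side of the convex hull, traversed counterclockwise. -/
def IsHullEdge (pos : V → Plane) (a b : V) : Prop :=
  a ≠ b ∧ ∀ z, 0 ≤ orient (pos a) (pos b) (pos z)

lemma IsLabelling.isHullEdge {n : ℕ} {e : Fin n ≃ V} (he : IsLabelling pos e) {i : ℕ}
    (h : i + 1 < n) : IsHullEdge pos (e ⟨i, by omega⟩) (e ⟨i + 1, h⟩) := by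
  refine ⟨e.injective.ne (by simp), fun z => ?_⟩
  obtain ⟨⟨j, hj⟩, rfl⟩ := e.surjective z
  rcases lt_trichotomy j i with hji | rfl | hji
  · rw [orient_rotate]
    exact (he _ _ _ (by simpa using hji) (by simp)).le
  · rw [orient_left]
  · rcases Nat.eq_or_lt_of_le (Nat.succ_le_of_lt hji) with h' | h'
    · subst h'; rw [orient_right]
    · exact (he _ _ _ (by simp) (by simpa using h')).le

lemma IsLabelling.isHullEdge_last {n : ℕ} {e : Fin (n + 1) ≃ V} (he : IsLabelling pos e)
    (hn : 0 < n) : IsHullEdge pos (e (Fin.last n)) (e 0) := by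
  refine ⟨e.injective.ne (by simp [Fin.ext_iff]; omega), fun z => ?_⟩
  obtain ⟨j, rfl⟩ := e.surjective z
  rcases eq_or_ne j 0 with rfl | h0
  · rw [orient_right]
  rcases eq_or_ne j (Fin.last n) with rfl | h1
  · rw [orient_left]
  rw [← orient_rotate]
  exact (he _ _ _ (Fin.pos_of_ne_zero h0) (Fin.lt_last_iff_ne_last.2 h1)).le

lemma IsHullEdge.legal [Finite V] (hc : ConvexIndependent ℝ pos) {var : Variant} {a b : V}
    (h : IsHullEdge pos a b) (hadj : ¬ G.Adj a b) : Legal pos var G a b := by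
  refine legal_of_orient_nonneg hc h.1 (fun z _ => h.2 z) fun v w hvw => ?_
  refine disjoint_of_orient_nonneg (h.2 v) (h.2 w) ?_
  by_contra! h0
  have hvw' := hvw.ne
  rcases eq_or_eq_of_orient_eq_zero hc h.1 h0.1 with rfl | rfl <;>
    rcases eq_or_eq_of_orient_eq_zero hc h.1 h0.2 with rfl | rfl
  · exact hvw' rfl
  · exact hadj hvw
  · exact hadj hvw.symm
  · exact hvw' rfl

lemma hullUnion_congr {G' : SimpleGraph V} (h : ∀ u v, G'.Reachable u v ↔ G.Reachable u v) :
    hullUnion pos G' = hullUnion pos G := by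
  have : ∀ v, comp G' v = comp G v := fun v => by ext w; exact h v w
  simp [hullUnion, this]

lemma hullUnion_of_reachable (h : ∀ u v, G.Reachable u v) [Nonempty V] :
    hullUnion pos G = convexHull ℝ (Set.range pos) := by
  have : ∀ v, comp G v = Set.univ := fun v => by ext w; simp [comp, h v w]
  simp [hullUnion, this, Set.iUnion_const]

lemma reachable_of_numComp_eq_one [Finite V] (h : numComp G = 1) (u v : V) : G.Reachable u v := by
  obtain ⟨l, -, hl⟩ := exists_label h
  exact (hl u v).1 (Subsingleton.elim _ _)

/-- As long as some area is left, there is a legal edge. -/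
lemma exists_legal [Finite V] (hc : ConvexIndependent ℝ pos) {var : Variant}
    (hG : Noncrossing pos G)
    (h : volume (convexHull ℝ (Set.range pos) \ scoredRegion pos var G) ≠ 0) :
    ∃ a b, Legal pos var G a b := by
  by_contra! hno
  have hsat : Saturated pos var G := fun a b hab => absurd hab (hno a b)
  rcases isEmpty_or_nonempty V with hV | ⟨⟨p⟩⟩
  · simp [Set.range_eq_empty] at h
  have : Nonempty V := ⟨p⟩
  refine h ?_
  rw [← hullUnion_of_reachable (G := G) ?_]
  · exact hsat.volume_hullUnion_diff hc hG
  obtain ⟨n, hn⟩ : ∃ n, Nat.card V = n + 1 :=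
    ⟨Nat.card V - 1, by have := Nat.card_pos (α := V); omega⟩
  obtain ⟨e, -, he⟩ := exists_labelling hc hn p
  have hall : ∀ i (hi : i < n + 1), G.Reachable (e 0) (e ⟨i, hi⟩) := by
    intro i
    induction i with
    | zero => intro _; exact .rfl
    | succ i ih =>
      intro hi
      refine (ih (by omega)).trans ?_
      by_contra hr
      exact hno _ _ ((he.isHullEdge hi).legal hc fun hadj => hr hadj.reachable)
  intro u v
  obtain ⟨i, rfl⟩ := e.surjective u
  obtain ⟨j, rfl⟩ := e.surjective v
  exact (hall i i.2).symm.trans (hall j j.2)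

lemma scoredRegion_draw_of_not_closesPolygon {var : Variant} {a b : V} (hab : a ≠ b)
    (h : ¬ ClosesPolygon pos var G a b) :
    scoredRegion pos var (draw G a b) ⊆ scoredRegion pos var G := by
  rintro x ⟨u, c, hcyc, hx⟩
  have hnot : s(a, b) ∉ c.edges := fun hmem => h ⟨u, c, hcyc, hmem⟩
  have hG : ∀ e ∈ c.edges, e ∈ G.edgeSet := by
    intro e he
    induction e using Sym2.ind with
    | _ v w =>
      rcases (draw_adj hab).1 (c.adj_of_mem_edges he) with h1 | h1
      · exact h1
      · exact absurd (h1 ▸ he) hnot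
  have hcurve : curve pos (c.transfer G hG) = curve pos c := by
    ext y; simp [curve]
  have henc : enclosed pos (c.transfer G hG) = enclosed pos c := by
    simp [enclosed, hcurve]
  exact ⟨u, c.transfer G hG, ⟨hcyc.1.transfer hG, fun hv v => henc ▸ hcyc.2 hv v⟩, henc ▸ hx⟩

/-- The area that can be scored without joining components and has not been scored yet. -/
noncomputable def avail (pos : V → Plane) (var : Variant) (G : SimpleGraph V) : ℝ :=
  (volume (hullUnion pos G \ scoredRegion pos var G)).toReal

lemma avail_nonneg (var : Variant) : 0 ≤ avail pos var G := ENNReal.toReal_nonneg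

lemma toReal_volume_diff_add [Finite V] {A B C : Set Plane} (hAB : A ⊆ B) (hBC : B ⊆ C)
    (hC : C ⊆ convexHull ℝ (Set.range pos)) (hB : MeasurableSet B) :
    (volume (C \ B)).toReal + (volume (B \ A)).toReal = (volume (C \ A)).toReal := by
  have hunion : C \ A = (C \ B) ∪ (B \ A) := by
    ext x
    simp only [Set.mem_sdiff, Set.mem_union]
    have := @hAB x
    have := @hBC x
    tauto
  have hdisj : Disjoint (B \ A) (C \ B) := by
    rw [Set.disjoint_left]; rintro x ⟨h1, -⟩ ⟨-, h2⟩; exact h2 h1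
  have hfin : ∀ S ⊆ C, volume S ≠ ⊤ := fun S hS => volume_ne_top_of_subset_hull (hS.trans hC)
  have hmeas : volume (C \ A) = volume (C \ B) + volume (B \ A) := by
    have h1 := measure_inter_add_sdiff (μ := volume) (C \ A) hB
    have e1 : (C \ A) ∩ B = B \ A := by
      ext x; have := @hBC x; simp only [Set.mem_inter_iff, Set.mem_sdiff]; tauto
    have e2 : (C \ A) \ B = C \ B := by
      ext x; have := @hAB x; simp only [Set.mem_sdiff]; tauto
    rw [e1, e2] at h1
    rw [← h1, add_comm]
  rw [hmeas, ENNReal.toReal_add (hfin _ Set.sdiff_subset) (hfin _ (Set.sdiff_subset.trans hBC))]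

/-- `G'` arises from `G` by joining the components of `a` and `b`, as far as connectivity is
concerned. -/
def Merged (G : SimpleGraph V) (a b : V) (G' : SimpleGraph V) : Prop :=
  ¬ G.Reachable a b ∧ ∀ u v, G'.Reachable u v ↔ G.Reachable u v ∨
    (G.Reachable u a ∧ G.Reachable b v) ∨ (G.Reachable u b ∧ G.Reachable a v)

lemma merged_draw {a b : V} (h : ¬ G.Reachable a b) : Merged G a b (draw G a b) :=
  ⟨h, fun _ _ => reachable_draw_iff (by rintro rfl; exact h .rfl)⟩

lemma Merged.congr {G₀ G' G'' : SimpleGraph V} {a b : V} (h : Merged G a b G')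
    (h₀ : ∀ u v, G.Reachable u v ↔ G₀.Reachable u v)
    (h' : ∀ u v, G''.Reachable u v ↔ G'.Reachable u v) : Merged G₀ a b G'' := by
  refine ⟨fun hr => h.1 ((h₀ _ _).2 hr), fun u v => ?_⟩
  rw [h', h.2]; simp only [h₀]

lemma Merged.mono {G' : SimpleGraph V} {a b u v : V} (h : Merged G a b G')
    (hr : G.Reachable u v) : G'.Reachable u v := (h.2 u v).2 (.inl hr)

lemma Merged.numComp [Finite V] {G' : SimpleGraph V} {a b : V} (h : Merged G a b G') :
    numComp G' + 1 = numComp G := by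
  have hab : a ≠ b := by rintro rfl; exact h.1 .rfl
  rw [← numComp_draw h.1, numComp_eq_of_reachable_iff (G := draw G a b) (G' := G')]
  intro u v; rw [h.2, reachable_draw_iff hab]

/-- Joining the components of `a` and `b` makes at most the difference between the new hull and
the old ones available. -/
lemma hullUnion_draw_subset {a b : V} (h : ¬ G.Reachable a b) :
    hullUnion pos (draw G a b) ⊆
      hullUnion pos G ∪ convexHull ℝ (pos '' (comp G a ∪ comp G b)) := by
  have hm := merged_draw h
  refine Set.iUnion_subset fun v => ?_
  by_cases hv : G.Reachable v a ∨ G.Reachable v b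
  · refine Set.subset_union_of_subset_right (convexHull_mono (Set.image_mono ?_)) _
    intro w hw
    rcases (hm.2 v w).1 hw with h1 | ⟨-, h1⟩ | ⟨-, h1⟩
    · rcases hv with hv | hv
      · exact .inl (hv.symm.trans h1)
      · exact .inr (hv.symm.trans h1)
    · exact .inr h1
    · exact .inl h1
  · refine Set.subset_union_of_subset_left (Set.subset_iUnion_of_subset v
      (convexHull_mono (Set.image_mono ?_))) _
    intro w hw
    rcases (hm.2 v w).1 hw with h1 | ⟨h1, -⟩ | ⟨h1, -⟩
    · exact h1
    · exact absurd (.inl h1) hv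
    · exact absurd (.inr h1) hv

end

lemma Player.other_ne (X : Player) : X.other ≠ X := by cases X <;> simp [Player.other]

lemma Player.other_other (X : Player) : X.other.other = X := by cases X <;> rfl

lemma Player.eq_other_of_ne {X Z : Player} (h : X ≠ Z) : X = Z.other := by
  cases X <;> cases Z <;> simp_all [Player.other]

section

variable {V : Type*} {pos : V → Plane}

/-- What holds throughout the game when `Z` is the player who moves at an odd number of
components. -/
structure StateInvariant (pos : V → Plane) (var : Variant) (Z : Player) (s : State V) : Prop where
  noncrossing : Noncrossing pos s.drawn
  score_add : s.score Z + s.score Z.other = (volume (scoredRegion pos var s.drawn)).toReal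
  turn_iff : s.turn = Z ↔ Odd (numComp s.drawn)

lemma stateInvariant_initial [Finite V] (hc : ConvexIndependent ℝ pos) (var : Variant) {Z : Player}
    (h : Player.R = Z ↔ Odd (Nat.card V)) : StateInvariant pos var Z (State.initial V) where
  noncrossing := by intro v w x y h; simp [State.initial] at h
  score_add := by simp [State.initial, volume_scoredRegion_bot hc]
  turn_iff := by simpa [State.initial, numComp_bot] using h

lemma gain_eq [Finite V] (hc : ConvexIndependent ℝ pos) (var : Variant) (G : SimpleGraph V)
    (a b : V) : gain pos var G a b = (volume (scoredRegion pos var (draw G a b))).toReal -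
      (volume (scoredRegion pos var G)).toReal := by
  have := toReal_volume_diff_add (pos := pos) (Set.empty_subset (scoredRegion pos var G))
    (scoredRegion_mono hc var (le_draw a b))
    ((scoredRegion_subset_hullUnion var).trans hullUnion_subset_hull)
    (isOpen_scoredRegion var).measurableSet
  simp only [Set.sdiff_empty] at this
  rw [gain]; linarith

lemma score_play_turn (var : Variant) (s : State V) (a b : V) :
    (s.play pos var a b).score s.turn = s.score s.turn + gain pos var s.drawn a b := by
  simp [State.play]

lemma score_play_of_ne (var : Variant) (s : State V) (a b : V) {X : Player} (h : X ≠ s.turn) :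
    (s.play pos var a b).score X = s.score X := by
  simp [State.play, h]

lemma StateInvariant.play [Finite V] (hc : ConvexIndependent ℝ pos) {var : Variant} {Z : Player}
    {s : State V} (hs : StateInvariant pos var Z s) {a b : V} (hl : Legal pos var s.drawn a b) :
    StateInvariant pos var Z (s.play pos var a b) where
  noncrossing := hs.noncrossing.draw hl
  score_add := by
    have hg := gain_eq hc var s.drawn a b
    have h0 := hs.score_add
    have hdrawn : (s.play pos var a b).drawn = draw s.drawn a b := rfl
    rw [hdrawn]
    by_cases h : s.turn = Z
    · rw [← h, score_play_turn, score_play_of_ne _ _ _ _ (Player.other_ne _)]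
      rw [← h] at h0
      linarith
    · have h' := Player.eq_other_of_ne h
      rw [← h', score_play_turn, score_play_of_ne _ _ _ _ (Ne.symm h)]
      rw [← h'] at h0
      linarith
  turn_iff := by
    have hcl := closesPolygon_iff hc (var := var) hl.1 hl.not_adj
    simp only [State.play]
    by_cases hr : s.drawn.Reachable a b
    · rw [if_pos (hcl.2 hr), hs.turn_iff,
        numComp_eq_of_reachable_iff fun u v => reachable_draw_of_reachable hl.1 hr]
    · rw [if_neg (fun h => hr (hcl.1 h))]
      have h1 := numComp_draw hr
      have h2 := hs.turn_iff
      rw [← h1, Nat.odd_add_one] at h2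
      rw [← not_iff_not, ← h2]
      constructor
      · intro h; by_contra h'
        exact h (by rw [Player.eq_other_of_ne h', Player.other_other])
      · rintro h h'
        rw [h] at h'
        exact Player.other_ne Z h'

lemma turn_play_of_reachable [Finite V] (hc : ConvexIndependent ℝ pos) {var : Variant}
    {s : State V} {a b : V} (hl : Legal pos var s.drawn a b) (hr : s.drawn.Reachable a b) :
    (s.play pos var a b).turn = s.turn := by
  simp [State.play, (closesPolygon_iff hc (var := var) hl.1 hl.not_adj).2 hr]

lemma turn_play_of_not_reachable [Finite V] (hc : ConvexIndependent ℝ pos) {var : Variant}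
    {s : State V} {a b : V} (hl : Legal pos var s.drawn a b) (hr : ¬ s.drawn.Reachable a b) :
    (s.play pos var a b).turn = s.turn.other := by
  simp [State.play, mt (closesPolygon_iff hc (var := var) hl.1 hl.not_adj).1 hr]

lemma gain_of_not_reachable [Finite V] (hc : ConvexIndependent ℝ pos) {var : Variant}
    {G : SimpleGraph V} {a b : V} (hl : Legal pos var G a b) (hr : ¬ G.Reachable a b) :
    gain pos var G a b = 0 := by
  have := scoredRegion_draw_of_not_closesPolygon hl.1
    (mt (closesPolygon_iff hc (var := var) hl.1 hl.not_adj).1 hr)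
  rw [gain, Set.sdiff_eq_empty.2 this]; simp

lemma gain_add_avail [Finite V] (hc : ConvexIndependent ℝ pos) {var : Variant}
    {G : SimpleGraph V} {a b : V} (hab : a ≠ b) (hr : G.Reachable a b) :
    gain pos var G a b + avail pos var (draw G a b) = avail pos var G := by
  have hU : hullUnion pos (draw G a b) = hullUnion pos G :=
    hullUnion_congr fun u v => reachable_draw_of_reachable hab hr
  have := toReal_volume_diff_add (pos := pos) (scoredRegion_mono hc var (le_draw (G := G) a b))
    (hU ▸ scoredRegion_subset_hullUnion var) hullUnion_subset_hull
    (isOpen_scoredRegion var).measurableSet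
  rw [gain, avail, avail, hU]; linarith

lemma canSecure_of_isOver [Finite V] {var : Variant} {Z : Player}
    {s : State V} (hs : StateInvariant pos var Z s) (hover : s.IsOver pos var)
    (hY : s.score Z.other ≤ hullArea pos / 2) :
    CanSecure pos var Z (hullArea pos / 2) s := by
  refine .over s hover ?_
  have h0 : (volume (convexHull ℝ (Set.range pos) \ scoredRegion pos var s.drawn)).toReal = 0 := by
    rw [show volume _ = 0 from hover]; rfl
  have h1 := toReal_volume_diff_add (pos := pos) (Set.empty_subset (scoredRegion pos var s.drawn))
    ((scoredRegion_subset_hullUnion var).trans hullUnion_subset_hull) subset_rfl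
    (isOpen_scoredRegion var).measurableSet
  simp only [Set.sdiff_empty] at h1
  have h2 := hs.score_add
  rw [hullArea] at *
  linarith

/-- `Z` may close all available polygons before joining components. -/
lemma canSecure_of_saturated [Finite V] (hc : ConvexIndependent ℝ pos) {var : Variant} {Z : Player}
    {s : State V} (hs : StateInvariant pos var Z s) (ht : s.turn = Z)
    (hY : s.score Z.other ≤ hullArea pos / 2)
    (H : ∀ s' : State V, StateInvariant pos var Z s' → s'.turn = Z →
      s'.score Z.other = s.score Z.other →
      (∀ u v, s'.drawn.Reachable u v ↔ s.drawn.Reachable u v) → Saturated pos var s'.drawn →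
      ¬ s'.IsOver pos var → CanSecure pos var Z (hullArea pos / 2) s') :
    CanSecure pos var Z (hullArea pos / 2) s := by
  suffices h : ∀ (G : SimpleGraph V) (s' : State V), s'.drawn = G → StateInvariant pos var Z s' →
      s'.turn = Z → s'.score Z.other = s.score Z.other →
      (∀ u v, s'.drawn.Reachable u v ↔ s.drawn.Reachable u v) →
      CanSecure pos var Z (hullArea pos / 2) s' from
    h _ s rfl hs ht rfl fun _ _ => Iff.rfl
  intro G
  induction G using WellFoundedGT.induction with
  | _ G ih =>
  rintro s' rfl hs' ht' hsc hr
  by_cases hover : s'.IsOver pos var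
  · exact canSecure_of_isOver hs' hover (hsc ▸ hY)
  by_cases hsat : Saturated pos var s'.drawn
  · exact H s' hs' ht' hsc hr hsat hover
  simp only [Saturated, not_forall, not_not] at hsat
  obtain ⟨a, b, hl, hab⟩ := hsat
  refine .ownMove s' hover ht' a b hl (ih (draw s'.drawn a b) ?_ _ rfl (hs'.play hc hl) ?_ ?_ ?_)
  · exact lt_of_le_not_ge (le_draw a b) fun h => hl.not_adj (h (draw_adj_self hl.1))
  · rw [turn_play_of_reachable hc hl hab, ht']
  · rw [score_play_of_ne _ _ _ _ (by rw [ht']; exact Player.other_ne _), hsc]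
  · intro u v
    rw [← hr]; exact reachable_draw_of_reachable hl.1 hab

/-- The opponent scores at most the available area before having to join two components. -/
lemma canSecure_of_merged [Finite V] (hc : ConvexIndependent ℝ pos) {var : Variant} {Z : Player}
    {s : State V} (hs : StateInvariant pos var Z s) (ht : s.turn ≠ Z) {t : ℝ}
    (hY : s.score Z.other + avail pos var s.drawn ≤ t) (hT : t ≤ hullArea pos / 2)
    (H : ∀ (s' : State V) (a b : V), StateInvariant pos var Z s' → s'.turn = Z →
      s'.score Z.other ≤ t →
      Merged s.drawn a b s'.drawn → CanSecure pos var Z (hullArea pos / 2) s') :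
    CanSecure pos var Z (hullArea pos / 2) s := by
  suffices h : ∀ (G : SimpleGraph V) (s' : State V), s'.drawn = G → StateInvariant pos var Z s' →
      s'.turn ≠ Z → s'.score Z.other + avail pos var s'.drawn ≤ t →
      (∀ u v, s'.drawn.Reachable u v ↔ s.drawn.Reachable u v) →
      CanSecure pos var Z (hullArea pos / 2) s' from
    h _ s rfl hs ht hY fun _ _ => Iff.rfl
  intro G
  induction G using WellFoundedGT.induction with
  | _ G ih =>
  rintro s' rfl hs' ht' hsc hr
  have hav := avail_nonneg (pos := pos) (G := s'.drawn) var
  by_cases hover : s'.IsOver pos var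
  · exact canSecure_of_isOver hs' hover (by linarith)
  have hturn := Player.eq_other_of_ne ht'
  refine .opponentMove s' hover ht' (exists_legal hc hs'.noncrossing hover) fun a b hl => ?_
  have hscore := score_play_turn (pos := pos) var s' a b
  rw [hturn] at hscore
  by_cases hab : s'.drawn.Reachable a b
  · refine ih (draw s'.drawn a b) ?_ _ rfl (hs'.play hc hl) ?_ ?_ ?_
    · exact lt_of_le_not_ge (le_draw a b) fun h => hl.not_adj (h (draw_adj_self hl.1))
    · rw [turn_play_of_reachable hc hl hab]; exact ht'
    · rw [hscore]
      have := gain_add_avail hc (var := var) hl.1 hab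
      show _ + avail pos var (draw s'.drawn a b) ≤ t
      linarith
    · intro u v
      rw [← hr]; exact reachable_draw_of_reachable hl.1 hab
  · refine H _ a b (hs'.play hc hl) ?_ ?_ ((merged_draw hab).congr hr fun _ _ => Iff.rfl)
    · rw [turn_play_of_not_reachable hc hl hab, hturn, Player.other_other]
    · rw [hscore, gain_of_not_reachable hc hl hab]; linarith

/-- `Z` joins two components after having scored everything available; this makes the difference
between the new hull and the old ones available to the opponent. -/
lemma canSecure_of_join [Finite V] (hc : ConvexIndependent ℝ pos) {var : Variant} {Z : Player}
    {s : State V} (hs : StateInvariant pos var Z s) (ht : s.turn = Z) (hover : ¬ s.IsOver pos var)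
    (hsat : Saturated pos var s.drawn) {a b : V} (hl : Legal pos var s.drawn a b) {t : ℝ}
    (hgift : s.score Z.other + (volume (convexHull ℝ (pos '' (comp s.drawn a ∪ comp s.drawn b)) \
      hullUnion pos s.drawn)).toReal ≤ t)
    (H : ∀ s' : State V, StateInvariant pos var Z s' → s'.turn ≠ Z →
      s'.score Z.other + avail pos var s'.drawn ≤ t → Merged s.drawn a b s'.drawn →
      CanSecure pos var Z (hullArea pos / 2) s') :
    CanSecure pos var Z (hullArea pos / 2) s := by
  have hab := hsat a b hl
  refine .ownMove s hover ht a b hl (H _ (hs.play hc hl) ?_ ?_ (merged_draw hab))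
  · rw [turn_play_of_not_reachable hc hl hab, ht]; exact Player.other_ne _
  · rw [score_play_of_ne _ _ _ _ (by rw [ht]; exact Player.other_ne _)]
    refine le_trans (add_le_add_right ?_ _) hgift
    show avail pos var (draw s.drawn a b) ≤ _
    refine ENNReal.toReal_mono (volume_ne_top_of_subset_hull (Set.sdiff_subset.trans
      (convexHull_mono (Set.image_subset_range _ _)))) ?_
    set D := convexHull ℝ (pos '' (comp s.drawn a ∪ comp s.drawn b)) with hD
    have hsub : hullUnion pos (draw s.drawn a b) \ scoredRegion pos var (draw s.drawn a b) ⊆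
        (hullUnion pos s.drawn \ scoredRegion pos var s.drawn) ∪ (D \ hullUnion pos s.drawn) := by
      rintro x ⟨h1, h2⟩
      by_cases hx : x ∈ hullUnion pos s.drawn
      · exact .inl ⟨hx, fun h => h2 (scoredRegion_mono hc var (le_draw a b) h)⟩
      · exact .inr ⟨(hullUnion_draw_subset hab h1).resolve_left hx, hx⟩
    calc _ ≤ _ := measure_mono hsub
      _ ≤ _ := measure_union_le _ _
      _ = _ := by rw [hsat.volume_hullUnion_diff hc hs.noncrossing, zero_add]

lemma canSecure_of_numComp_eq_one [Finite V] [Nonempty V] (hc : ConvexIndependent ℝ pos)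
    {var : Variant} {Z : Player} {s : State V} (hs : StateInvariant pos var Z s)
    (h1 : numComp s.drawn = 1)
    (hY : s.score Z.other ≤ hullArea pos / 2) :
    CanSecure pos var Z (hullArea pos / 2) s := by
  refine canSecure_of_saturated hc hs (hs.turn_iff.2 (by rw [h1]; exact odd_one)) hY ?_
  intro s' hs' _ _ hr hsat hover
  refine absurd ?_ hover
  rw [State.IsOver, ← hullUnion_of_reachable (G := s'.drawn)
    (fun u v => (hr u v).2 (reachable_of_numComp_eq_one h1 u v))]
  exact hsat.volume_hullUnion_diff hc hs'.noncrossing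

lemma canSecure_of_numComp_eq_two [Finite V] [Nonempty V] (hc : ConvexIndependent ℝ pos)
    {var : Variant} {Z : Player} {s : State V} (hs : StateInvariant pos var Z s)
    (h2 : numComp s.drawn = 2)
    (hY : s.score Z.other + avail pos var s.drawn ≤ hullArea pos / 2) :
    CanSecure pos var Z (hullArea pos / 2) s := by
  refine canSecure_of_merged hc hs ?_ hY le_rfl ?_
  · rw [Ne, hs.turn_iff, h2]; decide
  · intro s' a b hs' _ hsc hm
    exact canSecure_of_numComp_eq_one hc hs' (by have := hm.numComp; omega) hsc

end

/-! ### Three components left -/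

section

variable {V : Type*} {pos : V → Plane} {G : SimpleGraph V}

lemma hullArea_nonneg : 0 ≤ hullArea pos := ENNReal.toReal_nonneg

/-- There are two ways to join components along the boundary of the hull such that the areas they
make available lie on different sides of a chord. -/
def SeparatedJoins (pos : V → Plane) (G : SimpleGraph V) : Prop :=
  ∃ x y a b c d : V, x ≠ y ∧ IsHullEdge pos a b ∧ IsHullEdge pos c d ∧
    ¬ G.Reachable a b ∧ ¬ G.Reachable c d ∧
    convexHull ℝ (pos '' (comp G a ∪ comp G b)) \ hullUnion pos G ⊆
      {z | 0 ≤ orient (pos x) (pos y) z} ∧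
    convexHull ℝ (pos '' (comp G c ∪ comp G d)) \ hullUnion pos G ⊆
      {z | orient (pos x) (pos y) z ≤ 0}

/-- Regions of the hull on different sides of a chord have together at most the area of the
hull. -/
lemma volume_add_le_hullArea [Finite V] {x y : Plane} (hxy : x ≠ y) {S T : Set Plane}
    (hS : S ⊆ convexHull ℝ (Set.range pos)) (hT : T ⊆ convexHull ℝ (Set.range pos))
    (hTm : MeasurableSet T) (hSx : S ⊆ {z | 0 ≤ orient x y z}) (hTx : T ⊆ {z | orient x y z ≤ 0}) :
    (volume S).toReal + (volume T).toReal ≤ hullArea pos := by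
  have hdisj : AEDisjoint volume S T :=
    measure_mono_null (fun z hz => le_antisymm (hTx hz.2) (hSx hz.1)) (volume_orient_eq_zero hxy)
  rw [← ENNReal.toReal_add (volume_ne_top_of_subset_hull hS) (volume_ne_top_of_subset_hull hT),
    ← measure_union₀ hTm.nullMeasurableSet hdisj]
  exact ENNReal.toReal_mono volume_hull_ne_top (measure_mono (Set.union_subset hS hT))

/-- With three components left, `Z` makes the cheaper one of two separated joins. -/
lemma canSecure_of_numComp_eq_three [Finite V] [Nonempty V] (hc : ConvexIndependent ℝ pos)
    {var : Variant} {Z : Player} {s : State V} (hs : StateInvariant pos var Z s)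
    (h3 : numComp s.drawn = 3) (hY : s.score Z.other ≤ 0)
    (H : ∀ G : SimpleGraph V, Noncrossing pos G →
      (∀ u v, G.Reachable u v ↔ s.drawn.Reachable u v) → SeparatedJoins pos G) :
    CanSecure pos var Z (hullArea pos / 2) s := by
  have hT := hullArea_nonneg (pos := pos)
  refine canSecure_of_saturated hc hs (hs.turn_iff.2 (by rw [h3]; decide)) (by linarith) ?_
  intro s' hs' ht' hsc hr hsat hover
  obtain ⟨x, y, a, b, c, d, hxy, hab, hcd, hrab, hrcd, hS, hT'⟩ := H _ hs'.noncrossing hr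
  have hsub : ∀ A : Set V, convexHull ℝ (pos '' A) \ hullUnion pos s'.drawn ⊆
      convexHull ℝ (Set.range pos) := fun A =>
    Set.sdiff_subset.trans (convexHull_mono (Set.image_subset_range _ _))
  have hsum := volume_add_le_hullArea (hc.injective.ne hxy) (hsub _) (hsub _)
    (((Set.toFinite _).isClosed_convexHull ℝ).measurableSet.diff measurableSet_hullUnion) hS hT'
  have hnum := numComp_eq_of_reachable_iff hr
  have hfin : ∀ a b, IsHullEdge pos a b → ¬ s'.drawn.Reachable a b →
      (volume (convexHull ℝ (pos '' (comp s'.drawn a ∪ comp s'.drawn b)) \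
        hullUnion pos s'.drawn)).toReal ≤ hullArea pos / 2 →
      CanSecure pos var Z (hullArea pos / 2) s' := by
    intro a b hab hr hle
    refine canSecure_of_join hc hs' ht' hover hsat (hab.legal hc fun h => hr h.reachable)
      (t := hullArea pos / 2) (by linarith) fun s'' hs'' _ hsc'' hm => ?_
    exact canSecure_of_numComp_eq_two hc hs'' (by have := hm.numComp; omega) hsc''
  rcases le_total (volume (convexHull ℝ (pos '' (comp s'.drawn a ∪ comp s'.drawn b)) \
      hullUnion pos s'.drawn)).toReal (hullArea pos / 2) with h | h
  · exact hfin a b hab hrab h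
  · exact hfin c d hcd hrcd (by linarith)

/-- Joining two isolated points makes no area available. -/
lemma canSecure_of_isolated [Finite V] (hc : ConvexIndependent ℝ pos)
    {var : Variant} {Z : Player} {s : State V} (hs : StateInvariant pos var Z s)
    (ht : s.turn = Z) (hY : s.score Z.other ≤ 0) {a b : V}
    (ha : ∀ z, s.drawn.Reachable a z → z = a) (hb : ∀ z, s.drawn.Reachable b z → z = b)
    (hl : ∀ G : SimpleGraph V, (∀ u v, G.Reachable u v ↔ s.drawn.Reachable u v) →
      Legal pos var G a b)
    (H : ∀ s' : State V, StateInvariant pos var Z s' → s'.turn ≠ Z →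
      s'.score Z.other + avail pos var s'.drawn ≤ 0 → Merged s.drawn a b s'.drawn →
      CanSecure pos var Z (hullArea pos / 2) s') :
    CanSecure pos var Z (hullArea pos / 2) s := by
  have hT := hullArea_nonneg (pos := pos)
  refine canSecure_of_saturated hc hs ht (by linarith) ?_
  intro s' hs' ht' hsc hr hsat hover
  refine canSecure_of_join hc hs' ht' hover hsat (hl _ hr) (t := 0) ?_
    fun s'' hs'' ht'' hsc'' hm => H s'' hs'' ht'' hsc'' (hm.congr hr fun _ _ => Iff.rfl)
  have hzero : volume (convexHull ℝ (pos '' (comp s'.drawn a ∪ comp s'.drawn b)) \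
      hullUnion pos s'.drawn) = 0 := by
    refine measure_mono_null (Set.sdiff_subset.trans ?_) (volume_segment_eq_zero hc a b)
    rw [← convexHull_pair]
    refine convexHull_mono ?_
    rintro _ ⟨z, hz | hz, rfl⟩
    · rw [ha z ((hr _ _).1 hz)]; simp
    · rw [hb z ((hr _ _).1 hz)]; simp
  rw [hzero, hsc]; simpa using hY

/-- If `x` and `y` belong to one component, joining it to a component on one side of the chord
`xy` makes area on that side only available. -/
lemma convexHull_diff_hullUnion_subset (hc : ConvexIndependent ℝ pos) (hG : Noncrossing pos G)
    {x y a b : V} (hxy : x ≠ y) (hr : G.Reachable x y) (ha : G.Reachable x a)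
    (hb : ¬ G.Reachable x b) (hpos : 0 < orient (pos x) (pos y) (pos b)) :
    convexHull ℝ (pos '' (comp G a ∪ comp G b)) \ hullUnion pos G ⊆
      {z | 0 ≤ orient (pos x) (pos y) z} := by
  rintro z ⟨hz, hzU⟩
  by_contra! hneg
  refine hzU (Set.mem_iUnion.2 ⟨a, mem_convexHull_of_orient_neg hc hxy (S := comp G a)
    (T := comp G b) ha.symm (ha.symm.trans hr) (fun w hw => ?_) hz (not_le.1 hneg)⟩)
  by_contra! hw'
  exact hb (hG.reachable_of_orient_neg hc hw hr (mul_neg_of_pos_of_neg hpos hw'))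

lemma exists_step {R : ℕ → Prop} {i k : ℕ} (hik : i ≤ k) (hi : R i) (hk : ¬ R k) :
    ∃ m, i ≤ m ∧ m + 1 ≤ k ∧ R m ∧ ¬ R (m + 1) := by
  by_contra! h
  have : ∀ j, i + j ≤ k → R (i + j) := by
    intro j
    induction j with
    | zero => intro _; exact hi
    | succ j ih => intro hj; exact h (i + j) (by omega) (by omega) (ih (by omega))
  exact hk (by have := this (k - i) (by omega); rwa [show i + (k - i) = k by omega] at this)

/-- A chord inside a component, with other components on both sides, separates two joins. -/
lemma separatedJoins_of_chord [Finite V] (hc : ConvexIndependent ℝ pos) (hG : Noncrossing pos G)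
    {x y p q : V} (hr : G.Reachable x y) (hp : 0 < orient (pos x) (pos y) (pos p))
    (hq : orient (pos x) (pos y) (pos q) < 0) (hxp : ¬ G.Reachable x p)
    (hxq : ¬ G.Reachable x q) : SeparatedJoins pos G := by
  have hxy : x ≠ y := by rintro rfl; simp [orient] at hp
  have : Nonempty V := ⟨x⟩
  obtain ⟨n, hn⟩ : ∃ n, Nat.card V = n + 1 :=
    ⟨Nat.card V - 1, by have := Nat.card_pos (α := V); omega⟩
  obtain ⟨e, he0, he⟩ := exists_labelling hc hn x
  obtain ⟨j, rfl⟩ := e.surjective y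
  obtain ⟨kp, rfl⟩ := e.surjective p
  obtain ⟨kq, rfl⟩ := e.surjective q
  subst he0
  have hj0 : 0 < j := Fin.pos_of_ne_zero fun h => hxy (by rw [h])
  have hleft : ∀ k, j < k → 0 < orient (pos (e 0)) (pos (e j)) (pos (e k)) :=
    fun k hk => he 0 j k hj0 hk
  have hright : ∀ k, 0 < k → k < j → orient (pos (e 0)) (pos (e j)) (pos (e k)) < 0 := by
    intro k h0 hk
    have h1 := he 0 k j h0 hk
    have h2 : orient (pos (e 0)) (pos (e j)) (pos (e k)) =
      -orient (pos (e 0)) (pos (e k)) (pos (e j)) := by simp [orient]; ring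
    linarith
  have hkp : j ≤ kp := by
    by_contra! h
    rcases eq_or_ne kp 0 with rfl | h0
    · simp [orient_left] at hp
    · linarith [hright kp (Fin.pos_of_ne_zero h0) h]
  have hkq : kq < j := by
    by_contra! h
    rcases eq_or_lt_of_le h with rfl | h
    · simp [orient_right] at hq
    · linarith [hleft kq h]
  let R : ℕ → Prop := fun i => ∃ h : i < n + 1, G.Reachable (e 0) (e ⟨i, h⟩)
  obtain ⟨m, hm1, hm2, ⟨hm, hRm⟩, hRm'⟩ := exists_step (R := R) (i := j) (k := kp) hkp
    ⟨j.2, hr⟩ (fun ⟨_, h⟩ => hxp h)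
  obtain ⟨m', hm1', hm2', ⟨hm', hRm1⟩, hRm1'⟩ := exists_step (R := R) (i := 0) (k := kq)
    (Nat.zero_le _) ⟨Nat.succ_pos n, .rfl⟩ (fun ⟨_, h⟩ => hxq h)
  have hmn : m + 1 < n + 1 := by omega
  have hmn' : m' + 1 < n + 1 := by omega
  have hb : ¬ G.Reachable (e 0) (e ⟨m + 1, hmn⟩) := fun h => hRm' ⟨hmn, h⟩
  have hb' : ¬ G.Reachable (e 0) (e ⟨m' + 1, hmn'⟩) := fun h => hRm1' ⟨hmn', h⟩
  refine ⟨e 0, e j, _, _, _, _, hxy, he.isHullEdge hmn, he.isHullEdge hmn',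
    fun h => hb (hRm.trans h), fun h => hb' (hRm1.trans h), ?_, ?_⟩
  · refine convexHull_diff_hullUnion_subset hc hG hxy hr hRm hb (hleft _ ?_)
    exact Fin.lt_def.2 (Nat.lt_succ_of_le hm1)
  · have h1 := convexHull_diff_hullUnion_subset hc hG hxy.symm hr.symm (hr.symm.trans hRm1)
      (fun h => hb' (hr.trans h)) (by
        rw [orient_swap]
        refine neg_pos.2 (hright _ (Fin.lt_def.2 (Nat.succ_pos _)) (Fin.lt_def.2 ?_))
        exact lt_of_le_of_lt hm2' hkq)
    refine h1.trans fun z hz => ?_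
    have hz' : 0 ≤ orient (pos (e j)) (pos (e 0)) z := hz
    rw [orient_swap] at hz'
    exact neg_nonneg.1 hz'

/-- If one of three components is a single point `c`, then either both its neighbours on the hull
belong to one component, and the chord between them can be used, or joining `c` to the one or the
other neighbour are separated joins. -/
lemma separatedJoins_of_singleton [Finite V] (hc : ConvexIndependent ℝ pos)
    (hG : Noncrossing pos G) (h3 : numComp G = 3) {c : V} (hsing : ∀ z, G.Reachable c z → z = c) :
    SeparatedJoins pos G := by
  classical
  obtain ⟨l, hsurj, hl⟩ := exists_label h3
  have hcard : 3 ≤ Nat.card V := by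
    simpa using Nat.card_le_card_of_surjective l hsurj
  obtain ⟨n, hn⟩ : ∃ n, Nat.card V = n + 1 := ⟨Nat.card V - 1, by omega⟩
  obtain ⟨e, he0, he⟩ := exists_labelling hc hn c
  subst he0
  have hn2 : 2 ≤ n := by omega
  have hsing' : ∀ k, k ≠ 0 → l (e k) ≠ l (e 0) := fun k hk h =>
    hk (e.injective (hsing _ ((hl _ _).1 h.symm)))
  let i1 : Fin (n + 1) := ⟨1, by omega⟩
  have h01 : (0 : Fin (n + 1)) < i1 := Fin.lt_def.2 Nat.one_pos
  have h1last : i1 < Fin.last n := Fin.lt_def.2 (by simp [i1]; omega)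
  have hswap : ∀ x y z : Plane, orient x z y = -orient x y z := by
    intro x y z; simp [orient]; ring
  by_cases hu : l (e i1) = l (e (Fin.last n))
  · obtain ⟨t, ht0, ht1⟩ : ∃ t, t ≠ l (e 0) ∧ t ≠ l (e i1) := by
      generalize l (e 0) = α
      generalize l (e i1) = β
      revert α β; decide
    obtain ⟨z, rfl⟩ := hsurj t
    obtain ⟨k, rfl⟩ := e.surjective z
    have hk0 : k ≠ 0 := by rintro rfl; exact ht0 rfl
    have hk1 : k ≠ i1 := by rintro rfl; exact ht1 rfl
    have hkl : k ≠ Fin.last n := by rintro rfl; exact ht1 hu.symm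
    refine separatedJoins_of_chord hc hG (x := e i1) (y := e (Fin.last n)) (p := e 0) (q := e k)
      ((hl _ _).1 hu) ?_ ?_ ?_ ?_
    · rw [orient_rotate]; exact he _ _ _ h01 h1last
    · rw [hswap]
      refine neg_lt_zero.2 (he _ _ _ ?_ (Fin.lt_last_iff_ne_last.2 hkl))
      refine Fin.lt_def.2 ?_
      have hk0' : (k : ℕ) ≠ 0 := fun h => hk0 (Fin.ext h)
      have hk1' : (k : ℕ) ≠ 1 := fun h => hk1 (Fin.ext h)
      show 1 < (k : ℕ)
      omega
    · exact fun h => hsing' _ h01.ne' ((hl _ _).2 h)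
    · exact fun h => ht1 ((hl _ _).2 h).symm
  · -- the last point `e b` of the component of `e 1` ends the separating chord
    set F : Finset (Fin (n + 1)) := Finset.univ.filter fun k => l (e k) = l (e i1) with hF
    have hFne : F.Nonempty := ⟨i1, by simp [hF]⟩
    set b := F.max' hFne with hb
    have hbF : l (e b) = l (e i1) := (Finset.mem_filter.1 (F.max'_mem hFne)).2
    have hble : ∀ k, l (e k) = l (e i1) → k ≤ b := fun k hk =>
      F.le_max' k (by simp [hF, hk])
    have h1b : i1 ≤ b := hble _ rfl
    have h0b : 0 < b := h01.trans_le h1b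
    have hbl : b < Fin.last n := by
      refine Fin.lt_last_iff_ne_last.2 fun h => hu ?_
      rw [← h, hbF]
    have hW : ∀ k, l (e k) = l (e (Fin.last n)) → b < k := by
      intro k hk
      by_contra! hkb
      have hk1 : k ≠ i1 := by rintro rfl; exact hu hk
      have hkb' : k < b := lt_of_le_of_ne hkb (by rintro rfl; exact hu (hbF.symm.trans hk))
      have hk0 : k ≠ 0 := by rintro rfl; exact hsing' (Fin.last n) (h01.trans h1last).ne' hk.symm
      have h1k : i1 < k := by
        refine Fin.lt_def.2 ?_
        have hk0' : (k : ℕ) ≠ 0 := fun h => hk0 (Fin.ext h)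
        have hk1' : (k : ℕ) ≠ 1 := fun h => hk1 (Fin.ext h)
        show 1 < (k : ℕ)
        omega
      have hneg : orient (pos (e i1)) (pos (e b)) (pos (e k)) *
          orient (pos (e i1)) (pos (e b)) (pos (e (Fin.last n))) < 0 := by
        refine mul_neg_of_neg_of_pos ?_ (he _ _ _ (h1k.trans hkb') hbl)
        rw [hswap]; exact neg_lt_zero.2 (he _ _ _ h1k hkb')
      have := hG.reachable_of_orient_neg hc ((hl _ _).1 hk) ((hl _ _).1 hbF.symm) hneg
      exact hu (((hl _ _).2 this).trans hk)
    refine ⟨e 0, e b, e (Fin.last n), e 0, e 0, e i1, e.injective.ne h0b.ne,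
      he.isHullEdge_last (by omega), he.isHullEdge (i := 0) (by omega), ?_, ?_, ?_, ?_⟩
    · exact fun h => hsing' _ (h01.trans h1last).ne' ((hl _ _).2 h)
    · exact fun h => hsing' _ h01.ne' ((hl _ _).2 h).symm
    · refine Set.sdiff_subset.trans (convexHull_min ?_ (convex_orient_nonneg _ _))
      rintro _ ⟨z, hz | hz, rfl⟩
      · obtain ⟨k, rfl⟩ := e.surjective z
        exact (he 0 b k h0b (hW k ((hl _ _).2 hz).symm)).le
      · rw [hsing z hz]; exact (orient_left _ _).ge
    · refine Set.sdiff_subset.trans (convexHull_min ?_ (convex_orient_nonpos _ _))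
      rintro _ ⟨z, hz | hz, rfl⟩
      · rw [hsing z hz]; exact (orient_left _ _).le
      · obtain ⟨k, rfl⟩ := e.surjective z
        have hk := ((hl _ _).2 hz).symm
        rcases eq_or_lt_of_le (hble k hk) with rfl | hkb
        · exact (orient_right _ _).le
        · have hk0 : k ≠ 0 := by rintro rfl; exact hsing' i1 h01.ne' hk.symm
          show orient _ _ _ ≤ 0
          rw [hswap]
          exact neg_nonpos.2 (he 0 k b (Fin.pos_of_ne_zero hk0) hkb).le

/-- If none of three components is a single point, those that do not contain `x` have at least
four points together. -/
lemma card_add_four_le [Fintype V] (h3 : numComp G = 3)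
    (hsing : ∀ c, ∃ z, G.Reachable c z ∧ z ≠ c) (x : V) {S : Finset V}
    (hS : ∀ z ∈ S, G.Reachable x z) : S.card + 4 ≤ Fintype.card V := by
  classical
  obtain ⟨l, hsurj, hl⟩ := exists_label h3
  have hsum := Finset.card_eq_sum_card_fiberwise (f := l) (s := Finset.univ) (t := Finset.univ)
    (fun _ _ => Finset.mem_coe.2 (Finset.mem_univ _))
  rw [Fin.sum_univ_three, Finset.card_univ] at hsum
  have h2 : ∀ i, 2 ≤ (Finset.univ.filter fun v => l v = i).card := by
    intro i
    obtain ⟨c, rfl⟩ := hsurj i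
    obtain ⟨z, hz, hzc⟩ := hsing c
    exact Finset.one_lt_card.2 ⟨z, by simp [(hl _ _).2 hz], c, by simp, hzc⟩
  have hx : S.card ≤ (Finset.univ.filter fun v => l v = l x).card := by
    refine Finset.card_le_card fun z hz => ?_
    simp [(hl _ _).2 (hS z hz)]
  have h0 := h2 0
  have h1 := h2 1
  have h2' := h2 2
  generalize l x = i at hx
  fin_cases i <;> simp at hx <;> omega

/-- Three components on less than six points: one is a single point. -/
lemma separatedJoins_of_card_lt_six [Fintype V] (hc : ConvexIndependent ℝ pos)
    (hG : Noncrossing pos G) (h3 : numComp G = 3) (hV : Fintype.card V < 6) :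
    SeparatedJoins pos G := by
  classical
  by_cases hsing : ∃ c, ∀ z, G.Reachable c z → z = c
  · obtain ⟨c, hsing⟩ := hsing
    exact separatedJoins_of_singleton hc hG h3 hsing
  push Not at hsing
  obtain ⟨l, hsurj, -⟩ := exists_label h3
  obtain ⟨x, -⟩ := hsurj 0
  obtain ⟨z, hz, hzx⟩ := hsing x
  have := card_add_four_le h3 hsing x (S := {x, z}) (by simp [hz])
  rw [Finset.card_pair hzx.symm] at this
  omega

/-- Three components, one of them with a chord that has at least `m` points on either side: if no
component is a single point and the chord does not separate two joins, then its component
contains all points on one side of it, so there are at least `m + 6` points. -/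
lemma separatedJoins_of_card_lt [Fintype V] (hc : ConvexIndependent ℝ pos)
    (hG : Noncrossing pos G) (h3 : numComp G = 3) {x y : V} (hr : G.Reachable x y)
    (hxy : x ≠ y) {A B : Finset V} (hA : ∀ z ∈ A, 0 < orient (pos x) (pos y) (pos z))
    (hB : ∀ z ∈ B, orient (pos x) (pos y) (pos z) < 0) (hAV : Fintype.card V < A.card + 6)
    (hBV : Fintype.card V < B.card + 6) : SeparatedJoins pos G := by
  classical
  by_cases hsing : ∃ c, ∀ z, G.Reachable c z → z = c
  · obtain ⟨c, hsing⟩ := hsing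
    exact separatedJoins_of_singleton hc hG h3 hsing
  push Not at hsing
  have key : ∀ C : Finset V, x ∉ C → y ∉ C → Fintype.card V < C.card + 6 →
      ∃ z ∈ C, ¬ G.Reachable x z := by
    intro C hx hy hC
    by_contra! h
    have := card_add_four_le h3 hsing x (S := insert x (insert y C)) (by
      intro z hz
      rcases Finset.mem_insert.1 hz with rfl | hz
      · exact .rfl
      · rcases Finset.mem_insert.1 hz with rfl | hz
        · exact hr
        · exact h z hz)
    rw [Finset.card_insert_of_notMem (by simp [hx, hxy]), Finset.card_insert_of_notMem hy] at this
    omega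
  obtain ⟨p, hp, hxp⟩ := key A (fun h => by simpa [orient_left] using hA x h)
    (fun h => by simpa [orient_right] using hA y h) hAV
  obtain ⟨q, hq, hxq⟩ := key B (fun h => by simpa [orient_left] using hB x h)
    (fun h => by simpa [orient_right] using hB y h) hBV
  exact separatedJoins_of_chord hc hG hr (hA p hp) (hB q hq) hxp hxq

end

/-! ### The strategies -/

section

variable {V : Type*} {pos : V → Plane} {G : SimpleGraph V}

lemma Merged.reachable_iff_of_bot {a b : V} {G' : SimpleGraph V}
    (h : Merged (⊥ : SimpleGraph V) a b G') (u v : V) :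
    G'.Reachable u v ↔ u = v ∨ (u = a ∧ v = b) ∨ (u = b ∧ v = a) := by
  rw [h.2]
  simp only [SimpleGraph.reachable_bot]
  tauto

lemma Merged.eq_of_reachable {a b u v : V} {G' : SimpleGraph V} (h : Merged G a b G')
    (hu : ∀ z, G.Reachable u z → z = u) (ha : u ≠ a) (hb : u ≠ b) (hr : G'.Reachable u v) :
    v = u := by
  rcases (h.2 u v).1 hr with h1 | ⟨h1, -⟩ | ⟨h1, -⟩
  · exact hu v h1
  · exact absurd (hu a h1).symm ha
  · exact absurd (hu b h1).symm hb

lemma Merged.reachable {a b : V} {G' : SimpleGraph V} (h : Merged G a b G') : G'.Reachable a b :=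
  (h.2 a b).2 (.inr (.inl ⟨.rfl, .rfl⟩))

lemma avail_bot [Finite V] (hc : ConvexIndependent ℝ pos) (var : Variant) :
    avail pos var (⊥ : SimpleGraph V) = 0 := by
  have hsat : Saturated pos var (⊥ : SimpleGraph V) := by
    intro a b hl hr
    exact hl.1 (by simpa using hr)
  have hnc : Noncrossing pos (⊥ : SimpleGraph V) := by
    intro v w x y h; exact absurd h (by simp)
  rw [avail, hsat.volume_hullUnion_diff hc hnc]; rfl

/-- An edge with an isolated end that crosses no drawn edge is legal. -/
lemma legal_of_isolated [Finite V] (hc : ConvexIndependent ℝ pos) {var : Variant} {a b : V}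
    (hab : a ≠ b) (ha : ∀ z, G.Reachable a z → z = a)
    (hd : ∀ v w, G.Adj v w →
      Disjoint (openSegment ℝ (pos a) (pos b)) (openSegment ℝ (pos v) (pos w))) :
    Legal pos var G a b :=
  legal_of_orient_nonneg hc hab (fun z hz => by rw [ha z hz, orient_left]) hd

/-- With four components left and nothing available, the opponent joins two components; it suffices
that this always leaves separated joins. -/
lemma canSecure_of_numComp_eq_four [Finite V] [Nonempty V] (hc : ConvexIndependent ℝ pos)
    {var : Variant} {Z : Player} {s : State V} (hs : StateInvariant pos var Z s)
    (h4 : numComp s.drawn = 4) (hY : s.score Z.other + avail pos var s.drawn ≤ 0)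
    (H : ∀ G : SimpleGraph V, Noncrossing pos G → numComp G = 3 →
      (∀ u v, s.drawn.Reachable u v → G.Reachable u v) → SeparatedJoins pos G) :
    CanSecure pos var Z (hullArea pos / 2) s := by
  have hT := hullArea_nonneg (pos := pos)
  refine canSecure_of_merged hc hs ?_ hY (by linarith) fun s' a b hs' _ hsc hm => ?_
  · rw [Ne, hs.turn_iff, h4]; decide
  have h3 : numComp s'.drawn = 3 := by have := hm.numComp; omega
  refine canSecure_of_numComp_eq_three hc hs' h3 hsc fun G hG hr => ?_
  exact H G hG ((numComp_eq_of_reachable_iff hr).trans h3) fun u v h => (hr u v).2 (hm.mono h)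

lemma canSecure_three [Fintype V] (hc : ConvexIndependent ℝ pos) (var : Variant)
    (hV : Fintype.card V = 3) :
    CanSecure pos var Player.R (hullArea pos / 2) (State.initial V) := by
  have : Nonempty V := Fintype.card_pos_iff.1 (by omega)
  have hN : Nat.card V = 3 := by rw [Nat.card_eq_fintype_card, hV]
  have hs : StateInvariant pos var Player.R (State.initial V) :=
    stateInvariant_initial hc var (by rw [hN]; decide)
  have h3 : numComp (State.initial V).drawn = 3 := by rw [← hN]; exact numComp_bot
  refine canSecure_of_numComp_eq_three hc hs h3 le_rfl fun G hG hr => ?_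
  exact separatedJoins_of_card_lt_six hc hG ((numComp_eq_of_reachable_iff hr).trans h3) (by omega)

lemma canSecure_four [Fintype V] (hc : ConvexIndependent ℝ pos) (var : Variant)
    (hV : Fintype.card V = 4) :
    CanSecure pos var Player.B (hullArea pos / 2) (State.initial V) := by
  have : Nonempty V := Fintype.card_pos_iff.1 (by omega)
  have hN : Nat.card V = 4 := by rw [Nat.card_eq_fintype_card, hV]
  have hs : StateInvariant pos var Player.B (State.initial V) :=
    stateInvariant_initial hc var (by rw [hN]; decide)
  refine canSecure_of_numComp_eq_four hc hs (by rw [← hN]; exact numComp_bot) ?_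
    fun G hG h3 _ => separatedJoins_of_card_lt_six hc hG h3 (by omega)
  show (0 : ℝ) + avail pos var ⊥ ≤ 0
  rw [avail_bot hc]; simp

lemma canSecure_five [Fintype V] (hc : ConvexIndependent ℝ pos) (var : Variant)
    (hV : Fintype.card V = 5) :
    CanSecure pos var Player.R (hullArea pos / 2) (State.initial V) := by
  have : Nonempty V := Fintype.card_pos_iff.1 (by omega)
  have hN : Nat.card V = 5 := by rw [Nat.card_eq_fintype_card, hV]
  have hs : StateInvariant pos var Player.R (State.initial V) :=
    stateInvariant_initial hc var (by rw [hN]; decide)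
  have h5 : numComp (State.initial V).drawn = 5 := by rw [← hN]; exact numComp_bot
  obtain ⟨a, b, hab⟩ := Fintype.exists_pair_of_one_lt_card (α := V) (by omega)
  refine canSecure_of_isolated hc hs rfl le_rfl (a := a) (b := b)
    (fun z hz => (SimpleGraph.reachable_bot.1 hz).symm)
    (fun z hz => (SimpleGraph.reachable_bot.1 hz).symm) (fun G hr => ?_) fun s' hs' _ hsc hm => ?_
  · refine legal_of_isolated hc hab (fun z hz => (SimpleGraph.reachable_bot.1 ((hr _ _).1 hz)).symm)
      fun v w hvw => absurd (SimpleGraph.reachable_bot.1 ((hr _ _).1 hvw.reachable)) hvw.ne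
  · refine canSecure_of_numComp_eq_four hc hs' (by have := hm.numComp; omega) hsc
      fun G hG h3 _ => separatedJoins_of_card_lt_six hc hG h3 (by omega)

/-- In a hexagon, every edge `ab` has a disjoint edge `xy` such that one of the two is a
diagonal. -/
lemma exists_disjoint_diagonal [Fintype V] (hc : ConvexIndependent ℝ pos)
    (hV : Fintype.card V = 6) {a b : V} (hab : a ≠ b) :
    ∃ x y, x ≠ y ∧ x ≠ a ∧ x ≠ b ∧ y ≠ a ∧ y ≠ b ∧
      0 < orient (pos a) (pos b) (pos x) * orient (pos a) (pos b) (pos y) ∧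
      ((∃ p q, 0 < orient (pos a) (pos b) (pos p) ∧ orient (pos a) (pos b) (pos q) < 0) ∨
        ∃ p q, 0 < orient (pos x) (pos y) (pos p) ∧ orient (pos x) (pos y) (pos q) < 0) := by
  have hN : Nat.card V = 5 + 1 := by rw [Nat.card_eq_fintype_card, hV]
  obtain ⟨e, rfl, he⟩ := exists_labelling hc hN a
  obtain ⟨j, rfl⟩ := e.surjective b
  have hne : ∀ {i k : Fin 6}, i ≠ k → e i ≠ e k := fun h => e.injective.ne h
  have hneg : ∀ i j k, i < k → k < j → orient (pos (e i)) (pos (e j)) (pos (e k)) < 0 := by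
    intro i j k h1 h2
    have h3 := he i k j h1 h2
    have h4 : orient (pos (e i)) (pos (e j)) (pos (e k)) =
      -orient (pos (e i)) (pos (e k)) (pos (e j)) := by simp [orient]; ring
    linarith
  fin_cases j
  · exact absurd rfl hab
  · exact ⟨e 2, e 4, hne (by decide), hne (by decide), hne (by decide), hne (by decide),
      hne (by decide),
      mul_pos (he 0 1 2 (by decide) (by decide)) (he 0 1 4 (by decide) (by decide)),
      .inr ⟨e 5, e 3, he 2 4 5 (by decide) (by decide), hneg 2 4 3 (by decide) (by decide)⟩⟩
  · exact ⟨e 3, e 4, hne (by decide), hne (by decide), hne (by decide), hne (by decide),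
      hne (by decide),
      mul_pos (he 0 2 3 (by decide) (by decide)) (he 0 2 4 (by decide) (by decide)),
      .inl ⟨e 3, e 1, he 0 2 3 (by decide) (by decide), hneg 0 2 1 (by decide) (by decide)⟩⟩
  · exact ⟨e 4, e 5, hne (by decide), hne (by decide), hne (by decide), hne (by decide),
      hne (by decide),
      mul_pos (he 0 3 4 (by decide) (by decide)) (he 0 3 5 (by decide) (by decide)),
      .inl ⟨e 4, e 1, he 0 3 4 (by decide) (by decide), hneg 0 3 1 (by decide) (by decide)⟩⟩
  · exact ⟨e 1, e 2, hne (by decide), hne (by decide), hne (by decide), hne (by decide),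
      hne (by decide), mul_pos_of_neg_of_neg (hneg 0 4 1 (by decide) (by decide))
        (hneg 0 4 2 (by decide) (by decide)),
      .inl ⟨e 5, e 1, he 0 4 5 (by decide) (by decide), hneg 0 4 1 (by decide) (by decide)⟩⟩
  · exact ⟨e 1, e 3, hne (by decide), hne (by decide), hne (by decide), hne (by decide),
      hne (by decide), mul_pos_of_neg_of_neg (hneg 0 5 1 (by decide) (by decide))
        (hneg 0 5 3 (by decide) (by decide)),
      .inr ⟨e 4, e 2, he 1 3 4 (by decide) (by decide), hneg 1 3 2 (by decide) (by decide)⟩⟩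

/-- On six points, `B` answers the first edge such that one of the two edges is a diagonal. -/
lemma canSecure_six [Fintype V] (hc : ConvexIndependent ℝ pos) (var : Variant)
    (hV : Fintype.card V = 6) :
    CanSecure pos var Player.B (hullArea pos / 2) (State.initial V) := by
  have : Nonempty V := Fintype.card_pos_iff.1 (by omega)
  have hT := hullArea_nonneg (pos := pos)
  have hN : Nat.card V = 6 := by rw [Nat.card_eq_fintype_card, hV]
  have hs : StateInvariant pos var Player.B (State.initial V) :=
    stateInvariant_initial hc var (by rw [hN]; decide)
  have h6 : numComp (State.initial V).drawn = 6 := by rw [← hN]; exact numComp_bot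
  refine canSecure_of_merged hc hs (t := 0) (by simp [State.initial]) ?_ (by linarith)
    fun s₁ a b hs₁ ht₁ hsc₁ hm₁ => ?_
  · show (0 : ℝ) + avail pos var ⊥ ≤ 0
    rw [avail_bot hc]; simp
  have hab : a ≠ b := by rintro rfl; exact hm₁.1 .rfl
  have hr₁ := Merged.reachable_iff_of_bot hm₁
  obtain ⟨x, y, hxy, hxa, hxb, hya, hyb, hside, hdiag⟩ := exists_disjoint_diagonal hc hV hab
  refine canSecure_of_isolated hc hs₁ ht₁ hsc₁ (a := x) (b := y) (fun z hz => ?_) (fun z hz => ?_)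
    (fun G hr => ?_) fun s₂ hs₂ _ hsc₂ hm₂ => ?_
  · rcases (hr₁ _ _).1 hz with h | h | h
    exacts [h.symm, absurd h.1 hxa, absurd h.1 hxb]
  · rcases (hr₁ _ _).1 hz with h | h | h
    exacts [h.symm, absurd h.1 hya, absurd h.1 hyb]
  · refine legal_of_isolated hc hxy (fun z hz => ?_) fun v w hvw => ?_
    · rcases (hr₁ _ _).1 ((hr _ _).1 hz) with h | h | h
      exacts [h.symm, absurd h.1 hxa, absurd h.1 hxb]
    have hdisj : Disjoint (openSegment ℝ (pos a) (pos b)) (openSegment ℝ (pos x) (pos y)) := by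
      rcases mul_pos_iff.1 hside with ⟨h1, h2⟩ | ⟨h1, h2⟩
      · exact disjoint_of_orient_nonneg h1.le h2.le (.inl h1.ne')
      · rw [openSegment_symm]
        refine disjoint_of_orient_nonneg ?_ ?_ (.inl ?_) <;> rw [orient_swap]
        · linarith
        · linarith
        · exact neg_ne_zero.2 h1.ne
    rcases (hr₁ _ _).1 ((hr _ _).1 hvw.reachable) with h | ⟨rfl, rfl⟩ | ⟨rfl, rfl⟩
    · exact absurd h hvw.ne
    · exact hdisj.symm
    · rw [openSegment_symm ℝ (pos v)]; exact hdisj.symm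
  · refine canSecure_of_numComp_eq_four hc hs₂
      (by have := hm₁.numComp; have := hm₂.numComp; omega) hsc₂ fun G hG h3 hr => ?_
    rcases hdiag with ⟨p, q, hp, hq⟩ | ⟨p, q, hp, hq⟩
    · exact separatedJoins_of_card_lt hc hG h3 (hr _ _ (hm₂.mono hm₁.reachable)) hab
        (A := {p}) (B := {q}) (by simpa using hp) (by simpa using hq) (by simp [hV]) (by simp [hV])
    · exact separatedJoins_of_card_lt hc hG h3 (hr _ _ hm₂.reachable) hxy
        (A := {p}) (B := {q}) (by simpa using hp) (by simpa using hq) (by simp [hV]) (by simp [hV])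

/-- On seven points, `R` first draws a diagonal with two points on one and three on the other
side. Whatever the opponent answers, two neighbouring points on one side are still isolated, and
`R` joins them. -/
lemma canSecure_seven [Fintype V] (hc : ConvexIndependent ℝ pos) (var : Variant)
    (hV : Fintype.card V = 7) :
    CanSecure pos var Player.R (hullArea pos / 2) (State.initial V) := by
  classical
  have : Nonempty V := Fintype.card_pos_iff.1 (by omega)
  have hT := hullArea_nonneg (pos := pos)
  have hN : Nat.card V = 7 := by rw [Nat.card_eq_fintype_card, hV]
  have hs : StateInvariant pos var Player.R (State.initial V) :=
    stateInvariant_initial hc var (by rw [hN]; decide)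
  have h7 : numComp (State.initial V).drawn = 7 := by rw [← hN]; exact numComp_bot
  obtain ⟨e, -, he⟩ := exists_labelling hc hN (Classical.arbitrary V)
  have hne : ∀ {i k : Fin 7}, i ≠ k → e i ≠ e k := fun h => e.injective.ne h
  have hneg : ∀ k, 0 < k → k < 3 → orient (pos (e 0)) (pos (e 3)) (pos (e k)) < 0 := by
    intro k h1 h2
    have h3 := he 0 k 3 h1 h2
    have h4 : orient (pos (e 0)) (pos (e 3)) (pos (e k)) =
      -orient (pos (e 0)) (pos (e k)) (pos (e 3)) := by simp [orient]; ring
    linarith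
  have hpos : ∀ k, 3 < k → 0 < orient (pos (e 0)) (pos (e 3)) (pos (e k)) :=
    fun k hk => he 0 3 k (by decide) hk
  have h03 : e 0 ≠ e 3 := hne (by decide)
  refine canSecure_of_isolated hc hs rfl le_rfl (a := e 0) (b := e 3)
    (fun z hz => (SimpleGraph.reachable_bot.1 hz).symm)
    (fun z hz => (SimpleGraph.reachable_bot.1 hz).symm) (fun G hr => ?_)
    fun s₁ hs₁ ht₁ hsc₁ hm₁ => ?_
  · exact legal_of_isolated hc h03
      (fun z hz => (SimpleGraph.reachable_bot.1 ((hr _ _).1 hz)).symm)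
      fun v w hvw => absurd (SimpleGraph.reachable_bot.1 ((hr _ _).1 hvw.reachable)) hvw.ne
  have hr₁ := Merged.reachable_iff_of_bot hm₁
  refine canSecure_of_merged hc hs₁ ht₁ hsc₁ (by linarith) fun s₂ a b hs₂ ht₂ hsc₂ hm₂ => ?_
  have hiso₁ : ∀ i, i ≠ 0 → i ≠ 3 → ∀ z, s₁.drawn.Reachable (e i) z → z = e i := by
    intro i h0 h3 z hz
    rcases (hr₁ _ _).1 hz with h | h | h
    exacts [h.symm, absurd h.1 (hne h0), absurd h.1 (hne h3)]
  have hfin : ∀ x y, IsHullEdge pos x y → (∀ z, s₂.drawn.Reachable x z → z = x) →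
      (∀ z, s₂.drawn.Reachable y z → z = y) →
      CanSecure pos var Player.R (hullArea pos / 2) s₂ := by
    intro x y hxy hx hy
    refine canSecure_of_isolated hc hs₂ ht₂ hsc₂ hx hy
      (fun G hr => hxy.legal hc fun h => hxy.1 (hx _ ((hr _ _).1 h.reachable)).symm)
      fun s₃ hs₃ _ hsc₃ hm₃ => ?_
    refine canSecure_of_numComp_eq_four hc hs₃
      (by have := hm₁.numComp; have := hm₂.numComp; have := hm₃.numComp; omega) hsc₃
      fun G hG h3 hr => ?_
    refine separatedJoins_of_card_lt hc hG h3
      (hr _ _ (hm₃.mono (hm₂.mono hm₁.reachable))) h03 (A := {e 4, e 5}) (B := {e 1, e 2})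
      ?_ ?_ ?_ ?_
    · simp only [Finset.mem_insert, Finset.mem_singleton]
      rintro z (rfl | rfl)
      exacts [hpos 4 (by decide), hpos 5 (by decide)]
    · simp only [Finset.mem_insert, Finset.mem_singleton]
      rintro z (rfl | rfl)
      exacts [hneg 1 (by decide) (by decide), hneg 2 (by decide) (by decide)]
    · rw [Finset.card_pair (hne (by decide))]; omega
    · rw [Finset.card_pair (hne (by decide))]; omega
  have hiso₂ : ∀ i, i ≠ 0 → i ≠ 3 → e i ≠ a → e i ≠ b →
      ∀ z, s₂.drawn.Reachable (e i) z → z = e i := fun i h0 h3 ha hb z hz =>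
    hm₂.eq_of_reachable (hiso₁ i h0 h3) ha hb hz
  by_cases h12 : (e 1 ≠ a ∧ e 1 ≠ b) ∧ (e 2 ≠ a ∧ e 2 ≠ b)
  · exact hfin _ _ (he.isHullEdge (i := 1) (by decide))
      (hiso₂ 1 (by decide) (by decide) h12.1.1 h12.1.2)
      (hiso₂ 2 (by decide) (by decide) h12.2.1 h12.2.2)
  by_cases h45 : (e 4 ≠ a ∧ e 4 ≠ b) ∧ (e 5 ≠ a ∧ e 5 ≠ b)
  · exact hfin _ _ (he.isHullEdge (i := 4) (by decide))
      (hiso₂ 4 (by decide) (by decide) h45.1.1 h45.1.2)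
      (hiso₂ 5 (by decide) (by decide) h45.2.1 h45.2.2)
  -- otherwise the opponent's edge crosses the diagonal
  exfalso
  obtain ⟨i, hi0, hi3, hi⟩ : ∃ i, 0 < i ∧ i < 3 ∧ (e i = a ∨ e i = b) := by
    by_contra! h
    exact h12 ⟨h 1 (by decide) (by decide), h 2 (by decide) (by decide)⟩
  obtain ⟨j, hj3, hj⟩ : ∃ j, 3 < j ∧ (e j = a ∨ e j = b) := by
    by_contra! h
    exact h45 ⟨h 4 (by decide), h 5 (by decide)⟩
  have hij : e i ≠ e j := hne (hi3.trans hj3).ne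
  have hnot : ∀ i j, 0 < i → i < 3 → 3 < j → Merged s₁.drawn (e i) (e j) s₂.drawn → False := by
    intro i j hi0 hi3 hj3 hm
    have h1 := hs₂.noncrossing.reachable_of_orient_neg hc hm.reachable (hm.mono hm₁.reachable)
      (mul_neg_of_neg_of_pos (hneg i hi0 hi3) (hpos j hj3))
    have hiso_i := hiso₁ i hi0.ne' hi3.ne
    have hiso_j := hiso₁ j (((by decide : (0 : Fin 7) < 3).trans hj3).ne') hj3.ne'
    rcases (hm.2 _ _).1 h1 with h | ⟨h, -⟩ | ⟨h, -⟩
    · exact hne hi0.ne (hiso_i _ h.symm)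
    · exact hne hi0.ne (hiso_i _ h.symm)
    · exact hne ((by decide : (0 : Fin 7) < 3).trans hj3).ne (hiso_j _ h.symm)
  rcases hi with rfl | rfl <;> rcases hj with hj | hj
  · exact hij hj.symm
  · subst hj; exact hnot i j hi0 hi3 hj3 hm₂
  · subst hj
    refine hnot i j hi0 hi3 hj3 ⟨fun h => hm₂.1 h.symm, fun u v => ?_⟩
    rw [hm₂.2 u v]; tauto
  · exact hij hj.symm

end

end DotsPolygons

theorem theorem4 (P : Finset DotsPolygons.Plane)
    (hP : ConvexIndependent ℝ (fun p : P => (p : DotsPolygons.Plane)))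
    (var : DotsPolygons.Variant) :
    ((P.card = 3 ∨ P.card = 5 ∨ P.card = 7) →
      DotsPolygons.CanSecure (fun p : P => (p : DotsPolygons.Plane)) var DotsPolygons.Player.R
        (DotsPolygons.hullArea (fun p : P => (p : DotsPolygons.Plane)) / 2)
        (DotsPolygons.State.initial P)) ∧
    ((P.card = 4 ∨ P.card = 6) →
      DotsPolygons.CanSecure (fun p : P => (p : DotsPolygons.Plane)) var DotsPolygons.Player.B
        (DotsPolygons.hullArea (fun p : P => (p : DotsPolygons.Plane)) / 2)
        (DotsPolygons.State.initial P)) := by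
  have hcard : Fintype.card P = P.card := Fintype.card_coe P
  refine ⟨?_, ?_⟩
  · rintro (h | h | h)
    · exact DotsPolygons.canSecure_three hP var (hcard.trans h)
    · exact DotsPolygons.canSecure_five hP var (hcard.trans h)
    · exact DotsPolygons.canSecure_seven hP var (hcard.trans h)
  · rintro (h | h)
    · exact DotsPolygons.canSecure_four hP var (hcard.trans h)
    · exact DotsPolygons.canSecure_six hP var (hcard.trans h)
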